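/- Let $p$ be an odd prime and let $K$ be a $p$-adic field (a finite extension of $\mathbb{Q}_p$) with valuation ring $R$, uniformizer $\pi$ and residue field of order $q$. Let $R^*$ be the group of units of $R$ and $R^{*2}$ its subgroup of squares. Fix $\alpha\in R^*\smallsetminus R^{*2}$, and let $\eta(b)=1$ for $b\in R^{*2}$ and $\eta(b)=-1$ for $b\in R^*\smallsetminus R^{*2}$. Let $|a|_K=q^{-v_\pi(a)}$ be the normalized absolute value. For $Q\in R[x_1,\dots,x_n]$ let \[ Z_Q(s)=\int_{R^n}|Q(x)|_K^{s}\,dx \qquad (s\in\mathbb{C},\ \operatorname{Re}(s)>0), \] where $dx$ is the Haar measure of total mass $1$ on $R^n$. A quadratic form over $R$ is a polynomial $Q(x)=xMx^{T}$ with $M$ a symmetric matrix over $R$. It is unimodular if $\det M\in R^*$; its rank is then the number of its variables, and its discriminant is the class of $\det M$ modulo $R^{*2}$. The zero form, in any number of variables, is also regarded as unimodular, of rank $0$ and discriminant $1$. Two forms are equivalent if an invertible $R$-linear change of coordinates takes one to the other. A direct sum $\bigoplus$ is a sum of forms in disjoint sets of variables. Let $Q$ be a quadratic form over $R$, equivalent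 to $\bigoplus_{i\in\mathbb{N}}\pi^iQ_i$, where each $Q_i$ is a unimodular quadratic form of rank $r_i$ and discriminant $d_i$, and almost all $Q_i$ are zero. (Variables that do not occur in the direct sum are allowed.) Let \[ r=\sum_i r_i,\quad r_{\mathrm{even}}=\sum_i r_{2i},\quad r_{\mathrm{odd}}=\sum_i r_{2i+1},\qquad d=\prod_i d_i,\quad d_{\mathrm{even}}=\prod_i d_{2i},\quad d_{\mathrm{odd}}=\prod_i d_{2i+1}, \] where discriminants are taken in $R^*/R^{*2}$. Then the integral defining $Z_Q(s)$ converges absolutely for $\operatorname{Re}(s)>0$, and with $t=q^{-s}$ it equals $f(t)/g(t)$ for some $f,g\in\mathbb{Q}[t]$ with $\gcd(f,g)=1$ and $g(0)=1$. For every such pair $(f,g)$ the denominator $g$ is as follows. Put $S=\{(0,1),(1,1),(1,\alpha),(2,-\alpha)\}$. (a) If $r=0$, then $g(t)=1$. (b) If $r>0$ and $\{(r_{\mathrm{even}},d_{\mathrm{even}}),(r_{\mathrm{odd}},d_{\mathrm{odd}})\}\subseteq S$, then (i) if $r_{\mathrm{even}}=r_{\mathrm{odd}}$, then $g(t)=1-t/q^{r/2}$;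 (ii) if $r_{\mathrm{even}}\neq r_{\mathrm{odd}}$, then $g(t)=1-t^2/q^r$. (c) If $r>0$ and $\{(r_{\mathrm{even}},d_{\mathrm{even}}),(r_{\mathrm{odd}},d_{\mathrm{odd}})\}\not\subseteq S$, then (i) if $r_{\mathrm{even}}\equiv r_{\mathrm{odd}}\equiv 1\pmod 2$, then $g(t)=1-t/q$; (ii) if $r_{\mathrm{even}}\equiv r_{\mathrm{odd}}\equiv 0\pmod 2$, then $g(t)=(1-t/q)\bigl(1-\eta((-1)^{r/2}d)\,t/q^{r/2}\bigr)$; (iii) if $r_{\mathrm{even}}\not\equiv r_{\mathrm{odd}}\pmod 2$, then $g(t)=(1-t/q)(1-t^2/q^r)$. -/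

import Mathlib

open Polynomial MeasureTheory ValuativeRel

noncomputable section

/-! ### Units modulo squares -/

/-- The group `Rˣ / Rˣ²` of units modulo squares of units. -/
abbrev SquareClass (R : Type*) [CommRing R] : Type _ :=
  Rˣ ⧸ (powMonoidHom 2 : Rˣ →* Rˣ).range

/-- The class of a unit modulo squares of units. -/
def squareClass {R : Type*} [CommRing R] (u : Rˣ) : SquareClass R :=
  QuotientGroup.mk u

theorem squareClass_eq_one_iff {R : Type*} [CommRing R] (u : Rˣ) :
    squareClass u = 1 ↔ IsSquare u := by
  unfold squareClass
  rw [QuotientGroup.eq_one_iff, MonoidHom.mem_range]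
  constructor
  · rintro ⟨v, rfl⟩
    exact ⟨v, by simp [pow_two]⟩
  · rintro ⟨v, rfl⟩
    exact ⟨v, by simp [pow_two]⟩

open Classical in
/-- The function `η`: it is `1` on the class of squares of units and `-1` on all other classes
of units. -/
def squareClassEta {R : Type*} [CommRing R] (c : SquareClass R) : ℚ :=
  if c = 1 then 1 else -1

open Classical in
theorem squareClassEta_squareClass {R : Type*} [CommRing R] (u : Rˣ) :
    squareClassEta (squareClass u) = if IsSquare u then 1 else -1 := by
  unfold squareClassEta
  simp only [squareClass_eq_one_iff]

/-! ### Quadratic forms over a commutative ring -/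

/-- The quadratic form `Q(x₁, …, xₙ) = (x₁, …, xₙ) A (x₁, …, xₙ)ᵀ` of a matrix, as a
polynomial. -/
def quadPoly {R : Type*} [CommRing R] {n : ℕ} (A : Matrix (Fin n) (Fin n) R) :
    MvPolynomial (Fin n) R :=
  ∑ i, ∑ j, MvPolynomial.C (A i j) * MvPolynomial.X i * MvPolynomial.X j

/-- The value of the polynomial `quadPoly A` at `x` is that of Mathlib's quadratic form of `A`. -/
theorem eval_quadPoly {R : Type*} [CommRing R] {n : ℕ} (A : Matrix (Fin n) (Fin n) R)
    (x : Fin n → R) :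
    MvPolynomial.eval x (quadPoly A) = A.toQuadraticForm' x := by
  simp only [quadPoly, Matrix.toQuadraticForm', map_sum, map_mul, MvPolynomial.eval_C,
    MvPolynomial.eval_X, LinearMap.BilinMap.toQuadraticMap_apply, Matrix.toLinearMap₂'_apply]
  refine Finset.sum_congr rfl fun i _ => Finset.sum_congr rfl fun j _ => ?_
  simp only [smul_eq_mul]
  ring

/-- The discriminant, in `Rˣ / Rˣ²`, of the quadratic form of a unimodular matrix `M`. -/
def unimodularDisc {R : Type*} [CommRing R] {k : ℕ} (M : Matrix (Fin k) (Fin k) R)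
    (hM : IsUnit M.det) : SquareClass R :=
  squareClass hM.unit

/-- The quadratic form `⨁ᵢ ϖ ^ i • Qᵢ`, where `i` runs over `0, …, N - 1` and `Qᵢ` is the form in
`ρ i` variables with matrix `M i`, regarded as a form in `(∑ᵢ ρ i) + m` variables, the last `m` of
which do not occur. -/
def diagonalSum {R : Type*} [CommRing R] (ϖ : R) {N : ℕ} {ρ : Fin N → ℕ}
    (M : ∀ i, Matrix (Fin (ρ i)) (Fin (ρ i)) R) (m : ℕ) :
    QuadraticForm R ((∀ i, Fin (ρ i) → R) × (Fin m → R)) :=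
  QuadraticMap.prod (QuadraticMap.pi fun i => ϖ ^ (i : ℕ) • (M i).toQuadraticForm')
    (0 : QuadraticForm R (Fin m → R))

/-! ### The Igusa local zeta function -/

section Zeta

variable (R : Type*) [CommRing R] [IsDomain R] [IsDiscreteValuationRing R]

/-- The number `q` of elements of the residue field. -/
def residueCard : ℕ := Nat.card (IsLocalRing.ResidueField R)

variable {R}

open Classical in
/-- The normalized absolute value `|a| = q ^ (-v(a))`, with `|0| = 0`. -/
def normalizedAbs (a : R) : ℝ :=
  if a = 0 then 0 else (residueCard R : ℝ) ^ (-((IsDiscreteValuationRing.addVal R a).toNat : ℤ))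

variable [TopologicalSpace R] [IsTopologicalRing R] [CompactSpace R]
  [MeasurableSpace R] [BorelSpace R]

variable (R) in
/-- The Haar measure on the compact additive group `R ^ n` for which `R ^ n` has volume one. -/
def haarPi (n : ℕ) : Measure (Fin n → R) :=
  Measure.pi fun _ => Measure.addHaarMeasure (⊤ : TopologicalSpace.PositiveCompacts R)

/-- The Igusa local zeta function `Z_F(s) = ∫_{R ^ n} |F(x)| ^ s dx`, for `Re s > 0`. -/
def igusaZeta {n : ℕ} (F : MvPolynomial (Fin n) R) (s : ℂ) : ℂ :=
  ∫ x, ((normalizedAbs (MvPolynomial.eval x F) : ℝ) : ℂ) ^ s ∂(haarPi R n)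

/-- `Z_F = f(t) / g(t)` with `t = q ^ (-s)`, where the fraction is in lowest terms and the constant
coefficient of `g` is `1`. -/
structure IsReducedZetaFraction {n : ℕ} (F : MvPolynomial (Fin n) R) (f g : ℚ[X]) : Prop where
  coprime : IsCoprime f g
  coeff_zero : g.coeff 0 = 1
  denom_ne_zero : ∀ s : ℂ, 0 < s.re → aeval ((residueCard R : ℂ) ^ (-s)) g ≠ 0
  eq_div : ∀ s : ℂ, 0 < s.re →
    igusaZeta F s =
      aeval ((residueCard R : ℂ) ^ (-s)) f / aeval ((residueCard R : ℂ) ^ (-s)) g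

end Zeta

end

/-! Since 2 is a unit, every unimodular block diagonalizes, so `Q` is the pullback along a
surjective linear map of a diagonal form `∑ ϖ ^ e_j u_j y_j ^ 2` with units `u_j`. Such a map
preserves normalized Haar measure, and the zeta integral becomes the power series `∑ (a_k - a_{k+1})
t ^ k`, where `a_k` is the measure of the set on which `ϖ ^ k` divides the diagonal form
(`hasSum_integral_normalizedAbs_cpow`).

The measures are computed by sorting points according to the residues of the variables with `e_j =
0`. Let `c = q ^ (-n)`, where `n` is the number of these variables, and let `N` be the number of
nonzero zeros of the reduced form in them. At a nonzero residue vector the reduced form is smooth,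
so Hensel lifting makes each of the `N` isotropic vectors contribute `c q ^ (-k)` to `a_{k+1}`. At
the zero vector these variables are divisible by `ϖ`; substituting and dividing the form by `ϖ`
gives a diagonal form with exponents `shiftExp e`. Hence (`diagZeta_eq`) `Z_e = (1 - c - c N) + c N
(1 - 1/q) t / (1 - t/q) + c t Z_{shiftExp e}`.

The shift interchanges even and odd exponents and eventually makes all of them at most 1. From then
on it is an involution, and the two resulting relations can be solved for `Z`, with denominator
dividing `(1 - t/q)(1 - t ^ 2 / q ^ r)`. Gauss sums give `N` (`card_diagonal_zeros`), and the
explicit numerator shows what cancels. The set `S` lists exactly the ranks and discriminants of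
unimodular forms with anisotropic reduction (`mem_anisotropic_iff`); if both parts are of this kind,
all the `N` vanish and the factor `1 - t/q` never appears.

Undoing a shift does not change the denominator. If `Z_{shiftExp e}` has numerator `f` over `(1 -
t/q) h`, the new numerator is `J h + c t f`. It is coprime to `h` because `f`, `c` and `t` are. The
factor `1 - t/q` survives by positivity at its root: `J(q) = (q - 1) c N ≥ 0`, `h(q) ≥ 0`, and `f(q)
> 0` is carried along the induction. Finally a reduced fraction normalized by `g(0) = 1` is
determined by its values, so finding one suffices. -/

noncomputable section

/-! ### Diagonalization of unimodular symmetric matrices over a local ring -/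

section Diagonalization

variable {R : Type*} [CommRing R]

/-- Two square matrices are congruent if they are related by `M ↦ Pᵀ M P` with `P` invertible. -/
def MatrixCongruent {ι : Type*} [Fintype ι] [DecidableEq ι] (M N : Matrix ι ι R) : Prop :=
  ∃ P : Matrix ι ι R, IsUnit P.det ∧ P.transpose * M * P = N

namespace MatrixCongruent

variable {ι κ : Type*} [Fintype ι] [DecidableEq ι] [Fintype κ] [DecidableEq κ]

theorem refl (M : Matrix ι ι R) : MatrixCongruent M M :=
  ⟨1, by simp, by simp⟩

theorem trans {M N L : Matrix ι ι R} (h : MatrixCongruent M N) (h' : MatrixCongruent N L) :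
    MatrixCongruent M L := by
  obtain ⟨P, hP, rfl⟩ := h
  obtain ⟨P', hP', rfl⟩ := h'
  exact ⟨P * P', by simpa [Matrix.det_mul] using ⟨hP, hP'⟩,
    by simp [Matrix.transpose_mul, Matrix.mul_assoc]⟩

theorem isSymm {M N : Matrix ι ι R} (h : MatrixCongruent M N) (hM : M.IsSymm) : N.IsSymm := by
  obtain ⟨P, -, rfl⟩ := h
  simp [Matrix.IsSymm, Matrix.transpose_mul, hM.eq, Matrix.mul_assoc]

theorem isUnit_det {M N : Matrix ι ι R} (h : MatrixCongruent M N) (hM : IsUnit M.det) :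
    IsUnit N.det := by
  obtain ⟨P, hP, rfl⟩ := h
  rw [Matrix.det_mul, Matrix.det_mul, Matrix.det_transpose]
  exact (hP.mul hM).mul hP

theorem submatrix {M N : Matrix ι ι R} (h : MatrixCongruent M N) (e : κ ≃ ι) :
    MatrixCongruent (M.submatrix e e) (N.submatrix e e) := by
  obtain ⟨P, hP, rfl⟩ := h
  refine ⟨P.submatrix e e, by simpa using hP, ?_⟩
  rw [Matrix.transpose_submatrix, Matrix.submatrix_mul_equiv, Matrix.submatrix_mul_equiv]

/-- Completing the square: the shear by `-A⁻¹ B` removes the mixed terms and leaves the Schur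
complement. -/
theorem fromBlocks_schur (A : Matrix κ κ R) (B : Matrix κ ι R) (D : Matrix ι ι R)
    (hA : A.IsSymm) (hdet : IsUnit A.det) :
    MatrixCongruent (Matrix.fromBlocks A B B.transpose D)
      (Matrix.fromBlocks A 0 0 (D - B.transpose * A⁻¹ * B)) := by
  have h1 : A * A⁻¹ = 1 := Matrix.mul_nonsing_inv _ hdet
  have h2 : (A⁻¹).transpose = A⁻¹ := by rw [Matrix.transpose_nonsing_inv, hA.eq]
  have h3 : A⁻¹ * A = 1 := Matrix.nonsing_inv_mul _ hdet
  refine ⟨Matrix.fromBlocks 1 (-(A⁻¹ * B)) 0 1, by simp, ?_⟩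
  simp only [Matrix.fromBlocks_transpose, Matrix.fromBlocks_multiply, Matrix.transpose_one,
    Matrix.transpose_zero, Matrix.transpose_neg, Matrix.transpose_mul, h2]
  congr 1
  · simp
  · simp [← Matrix.mul_assoc, h1]
  · simp [Matrix.mul_assoc, h3]
  · simp [← Matrix.mul_assoc, Matrix.mul_assoc _ A⁻¹ A, h3]
    abel

theorem fromBlocks_right (A : Matrix κ κ R) {D D' : Matrix ι ι R} (h : MatrixCongruent D D') :
    MatrixCongruent (Matrix.fromBlocks A 0 0 D) (Matrix.fromBlocks A 0 0 D') := by
  obtain ⟨P, hP, rfl⟩ := h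
  refine ⟨Matrix.fromBlocks 1 0 0 P, by simpa using hP, ?_⟩
  simp [Matrix.fromBlocks_transpose, Matrix.fromBlocks_multiply]

/-- A unimodular symmetric matrix over a local ring with `2` invertible represents a unit. -/
theorem exists_isUnit_diag [IsLocalRing R] (h2 : IsUnit (2 : R)) [Nonempty ι]
    {M : Matrix ι ι R} (hM : M.IsSymm) (hdet : IsUnit M.det) :
    ∃ (N : Matrix ι ι R) (i : ι), MatrixCongruent M N ∧ IsUnit (N i i) := by
  by_cases hd : ∃ i, IsUnit (M i i)
  · obtain ⟨i, hi⟩ := hd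
    exact ⟨M, i, refl M, hi⟩
  push Not at hd
  obtain ⟨i⟩ := ‹Nonempty ι›
  obtain ⟨j, hj⟩ : ∃ j, IsUnit (M i j) := by
    by_contra! hcon
    have h0 : ((IsLocalRing.residue R).mapMatrix M).det = 0 := by
      refine Matrix.det_eq_zero_of_row_eq_zero i fun j => ?_
      rw [RingHom.mapMatrix_apply, Matrix.map_apply, IsLocalRing.residue_eq_zero_iff]
      exact hcon j
    rw [← RingHom.map_det, IsLocalRing.residue_eq_zero_iff] at h0
    exact h0 hdet
  have hij : i ≠ j := by
    rintro rfl
    exact hd _ hj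
  -- Replacing the basis vector `e_i` by `e_i + e_j` turns the diagonal entry into `M i i + 2 M i j
  -- + M j j`. Its outer terms lie in the maximal ideal and the middle one is a unit.
  refine ⟨_, i, ⟨Matrix.transvection j i 1, by simp [Matrix.det_transvection_of_ne _ _ hij.symm],
    rfl⟩, ?_⟩
  have ht : (Matrix.transvection j i (1 : R)).transpose = Matrix.transvection i j 1 := by
    simp [Matrix.transvection, Matrix.transpose_add]
  rw [ht, Matrix.mul_transvection_apply_same, Matrix.transvection_mul_apply_same,
    Matrix.transvection_mul_apply_same, hM.apply i j]
  have hmem : ∀ k, M k k ∈ IsLocalRing.maximalIdeal R := fun k => hd k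
  by_contra hcon
  have hcon' : (M i i + 1 * M i j + 1 * (M i j + 1 * M j j)) ∈ IsLocalRing.maximalIdeal R := hcon
  have h3 : 2 * M i j ∈ IsLocalRing.maximalIdeal R := by
    have := Ideal.sub_mem _ (Ideal.sub_mem _ hcon' (hmem i)) (hmem j)
    convert this using 1
    ring
  exact h3 (h2.mul hj)

/-- Over a local ring with `2` invertible, a unimodular symmetric matrix is congruent to a diagonal
matrix. -/
theorem exists_diagonal [IsLocalRing R] (h2 : IsUnit (2 : R)) (n : ℕ) :
    ∀ {ι : Type} [Fintype ι] [DecidableEq ι] (_ : Fintype.card ι = n) {M : Matrix ι ι R}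
      (_ : M.IsSymm) (_ : IsUnit M.det), ∃ w : ι → R, MatrixCongruent M (Matrix.diagonal w) := by
  induction n with
  | zero =>
    intro ι _ _ hc M _ _
    have := Fintype.card_eq_zero_iff.mp hc
    exact ⟨fun _ => 0, 1, by simp, Subsingleton.elim _ _⟩
  | succ n ih =>
    intro ι _ _ hc M hM hdet
    have : Nonempty ι := Fintype.card_pos_iff.mp (by omega)
    obtain ⟨N, i, hMN, hi⟩ := exists_isUnit_diag h2 hM hdet
    set e := Equiv.sumCompl (fun a : ι => a = i)
    have hN := hMN.isSymm hM
    have hNdet := hMN.isUnit_det hdet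
    set N' := N.submatrix e e with hN'
    have hN's : N'.IsSymm := hN.submatrix e
    have hb : N' = Matrix.fromBlocks N'.toBlocks₁₁ N'.toBlocks₁₂ N'.toBlocks₁₂.transpose
        N'.toBlocks₂₂ := by
      conv_lhs => rw [← Matrix.fromBlocks_toBlocks N']
      congr 1
      ext a b
      exact hN's.apply _ _
    have hA : N'.toBlocks₁₁.IsSymm := by
      ext a b
      exact hN's.apply _ _
    have hAdet : IsUnit N'.toBlocks₁₁.det := by
      rw [Matrix.det_unique]
      exact hi
    have h1 := fromBlocks_schur _ N'.toBlocks₁₂ N'.toBlocks₂₂ hA hAdet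
    rw [← hb] at h1
    have hN'det : IsUnit N'.det := by
      rw [hN', Matrix.det_submatrix_equiv_self]
      exact hNdet
    set S := N'.toBlocks₂₂ - N'.toBlocks₁₂.transpose * N'.toBlocks₁₁⁻¹ * N'.toBlocks₁₂
    have hSdet : IsUnit S.det := by
      have := h1.isUnit_det hN'det
      rw [Matrix.det_fromBlocks_zero₂₁] at this
      exact isUnit_of_mul_isUnit_right this
    have hS : S.IsSymm := by
      have := h1.isSymm hN's
      exact (Matrix.isSymm_fromBlocks_iff.mp this).2.2.2
    have hcard : Fintype.card {a // ¬ a = i} = n := by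
      rw [Fintype.card_subtype_compl, hc, Fintype.card_subtype_eq]
      rfl
    obtain ⟨w, hw⟩ := ih hcard hS hSdet
    have h3 := h1.trans (fromBlocks_right N'.toBlocks₁₁ hw)
    have hAd : N'.toBlocks₁₁ = Matrix.diagonal fun _ => N i i := by
      ext a b
      obtain rfl := Subsingleton.elim a b
      obtain ⟨a, rfl⟩ := a
      simp [hN', e, Matrix.toBlocks₁₁]
    rw [hAd, Matrix.fromBlocks_diagonal] at h3
    have h4 := h3.submatrix e.symm
    rw [hN', Matrix.submatrix_submatrix, Matrix.submatrix_diagonal_equiv] at h4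
    refine ⟨_, hMN.trans (by simpa using h4)⟩

end MatrixCongruent

end Diagonalization

end

noncomputable section

/-! ### Zeros of diagonal quadratic forms over a finite field -/

section Counting

variable {k : Type*} [Field k] [Fintype k] [DecidableEq k]

/-- An element `y` has `1 + χ(y)` square roots. Summing over `y = x ^ 2`, the constant 1 contributes
a full character sum, which vanishes, and `χ` contributes a Gauss sum twisted by `c`. -/
theorem sum_addChar_mul_sq {E : Type*} [Field E] [CharZero E] (hk : ringChar k ≠ 2)
    {ψ : AddChar k E} (hψ : ψ.IsPrimitive) {c : k} (hc : c ≠ 0) :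
    ∑ x, ψ (c * x ^ 2) = quadraticChar k c *
      gaussSum ((quadraticChar k).ringHomComp (Int.castRingHom E)) ψ := by
  have hq : ∀ y : k, (((Finset.univ.filter fun x : k => x ^ 2 = y).card : ℕ) : E)
      = quadraticChar k y + 1 := by
    intro y
    have h := quadraticChar_card_sqrts hk y
    rw [Set.toFinset_ofPred] at h
    exact_mod_cast congrArg (Int.cast : ℤ → E) h
  have h1 : ∑ x, ψ (c * x ^ 2) = ∑ y, ((quadraticChar k y : E) + 1) * ψ (c * y) := by
    rw [← Finset.sum_fiberwise_of_maps_to (t := Finset.univ) (g := fun x : k => x ^ 2)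
      (fun _ _ => Finset.mem_univ _)]
    refine Finset.sum_congr rfl fun y _ => ?_
    rw [← hq y, ← nsmul_eq_mul, ← Finset.sum_const]
    refine Finset.sum_congr rfl fun x hx => ?_
    rw [(Finset.mem_filter.mp hx).2]
  have h2 : ∑ y, ψ (c * y) = 0 := by
    simp_rw [mul_comm c]
    rw [AddChar.sum_mulShift c hψ, if_neg hc, Nat.cast_zero]
  rw [h1]
  simp_rw [add_mul, one_mul]
  rw [Finset.sum_add_distrib, h2, add_zero,
    ← gaussSum_mulShift _ ψ (Units.mk0 c hc), ← mul_assoc]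
  have h3 : (quadraticChar k c : E) *
      ((quadraticChar k).ringHomComp (Int.castRingHom E)) (Units.mk0 c hc) = 1 := by
    rw [MulChar.ringHomComp_apply, Units.val_mk0, eq_intCast, ← Int.cast_mul, ← pow_two,
      quadraticChar_sq_one hc, Int.cast_one]
  rw [h3, one_mul]
  simp [gaussSum, AddChar.mulShift_apply]

variable {κ : Type*} [Fintype κ]

theorem sum_addChar_diagonal [DecidableEq κ] {E : Type*} [Field E] [CharZero E]
    (hk : ringChar k ≠ 2)
    {ψ : AddChar k E} (hψ : ψ.IsPrimitive) {c : k} (hc : c ≠ 0) {w : κ → k} (hw : ∀ j, w j ≠ 0) :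
    ∑ y : κ → k, ψ (c * ∑ j, w j * y j ^ 2) =
      (quadraticChar k c : E) ^ Fintype.card κ * quadraticChar k (∏ j, w j) *
      gaussSum ((quadraticChar k).ringHomComp (Int.castRingHom E)) ψ ^ Fintype.card κ := by
  have h1 : ∀ y : κ → k, ψ (c * ∑ j, w j * y j ^ 2) = ∏ j, ψ (c * w j * y j ^ 2) := by
    intro y
    have h := map_prod ψ.toMonoidHom (fun j => Multiplicative.ofAdd (c * w j * y j ^ 2)) Finset.univ
    rw [← ofAdd_sum] at h
    rw [Finset.mul_sum]
    simp_rw [← mul_assoc]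
    exact h
  simp_rw [h1]
  rw [← Fintype.piFinset_univ,
    ← Finset.prod_univ_sum (fun _ => Finset.univ) fun j x => ψ (c * w j * x ^ 2)]
  simp_rw [sum_addChar_mul_sq hk hψ (mul_ne_zero hc (hw _))]
  rw [Finset.prod_mul_distrib, Finset.prod_const, Finset.card_univ]
  congr 1
  simp_rw [map_mul, Int.cast_mul]
  rw [Finset.prod_mul_distrib, Finset.prod_const, Finset.card_univ, map_prod, Int.cast_prod]

/-- The normalized invariant `χ((-1) ^ (n / 2) d) q ^ (-n / 2)` of a quadratic form of rank `n` and
discriminant `d` over a field with `q` elements; it is `0` if `n` is odd. -/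
def signRatio (χ : ℚ) (q : ℚ) (n : ℕ) : ℚ :=
  if Even n then χ / q ^ (n / 2) else 0

/-- The number of zeros of a nondegenerate diagonal quadratic form over a finite field of odd
characteristic. -/
theorem card_diagonal_zeros (hk : ringChar k ≠ 2) (w : κ → k) (hw : ∀ j, w j ≠ 0) :
    (Fintype.card k : ℚ) * (Nat.card {y : κ → k // ∑ j, w j * y j ^ 2 = 0} : ℚ) =
      (Fintype.card k : ℚ) ^ Fintype.card κ * (1 + (Fintype.card k - 1) *
        signRatio (quadraticChar k ((-1) ^ (Fintype.card κ / 2) * ∏ j, w j)) (Fintype.card k)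
          (Fintype.card κ)) := by
  classical
  have hchar : ringChar ℚ ≠ ringChar k := by
    rw [ringChar.eq_zero]
    exact (CharP.ringChar_ne_zero_of_finite k).symm
  set Ψ := AddChar.FiniteField.primitiveChar k ℚ hchar
  set E := CyclotomicField Ψ.n ℚ
  have hψ : Ψ.char.IsPrimitive := Ψ.prim
  set ψ : AddChar k E := Ψ.char
  set n := Fintype.card κ
  set q := Fintype.card k
  set χ := (quadraticChar k).ringHomComp (Int.castRingHom E) with hχ
  set G := gaussSum χ ψ
  have hq0 : (q : ℚ) ≠ 0 := by exact_mod_cast Fintype.card_ne_zero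
  have hχ1 : χ ≠ 1 := by
    refine (MulChar.ringHomComp_ne_one_iff (Int.cast_injective (α := E))).mpr
      (quadraticChar_ne_one hk)
  have hG : G ^ 2 = quadraticChar k (-1) * q :=
    gaussSum_sq hχ1 ((quadraticChar_isQuadratic k).comp _) hψ
  -- Orthogonality of characters: for fixed `y` the sum over `c` is `q` if the form vanishes at `y`,
  -- and 0 otherwise.
  have h1 : (q : E) * (Nat.card {y : κ → k // ∑ j, w j * y j ^ 2 = 0} : E) =
      ∑ c : k, ∑ y : κ → k, ψ (c * ∑ j, w j * y j ^ 2) := by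
    rw [Finset.sum_comm]
    simp_rw [AddChar.sum_mulShift _ hψ]
    rw [Nat.card_eq_fintype_card, Fintype.card_subtype]
    push_cast
    rw [← Finset.sum_filter, Finset.sum_const, nsmul_eq_mul, mul_comm]
  have h2 : ∑ c : k, ∑ y : κ → k, ψ (c * ∑ j, w j * y j ^ 2) = (q : E) ^ n +
      ∑ c ∈ Finset.univ.erase (0 : k),
        (quadraticChar k c : E) ^ n * quadraticChar k (∏ j, w j) * G ^ n := by
    rw [← Finset.add_sum_erase _ _ (Finset.mem_univ (0 : k))]
    congr 1
    · simp [q, n]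
    · exact Finset.sum_congr rfl fun c hc =>
        sum_addChar_diagonal hk hψ (Finset.ne_of_mem_erase hc) hw
  rw [h2, ← Finset.sum_mul, ← Finset.sum_mul] at h1
  -- The claim is rational, but the Gauss sum lives in a cyclotomic field; the identity is checked
  -- there. Only `G ^ 2 = χ(-1) q` is needed: for odd rank the coefficient of `G ^ n` is `∑ χ(c) =
  -- 0`.
  have hinj : Function.Injective (algebraMap ℚ E) := (algebraMap ℚ E).injective
  apply hinj
  simp only [map_mul, map_natCast, map_add, map_pow, map_sub, map_one]
  rw [h1]
  unfold signRatio
  split_ifs with hn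
  · obtain ⟨m, hm⟩ := hn
    have hm2 : n / 2 = m := by omega
    have hsum : ∑ c ∈ Finset.univ.erase (0 : k), (quadraticChar k c : E) ^ n = q - 1 := by
      rw [Finset.sum_congr rfl (g := fun _ => (1 : E)), Finset.sum_const, Finset.card_erase_of_mem
        (Finset.mem_univ _), Finset.card_univ, nsmul_eq_mul, mul_one, Nat.cast_sub Fintype.card_pos,
        Nat.cast_one]
      intro c hc
      have := quadraticChar_sq_one (Finset.ne_of_mem_erase hc)
      rw [hm, ← two_mul, pow_mul, ← Int.cast_pow, this, Int.cast_one, one_pow]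
    have hGn : G ^ n = (quadraticChar k (-1) : E) ^ m * (q : E) ^ m := by
      rw [hm, ← two_mul, pow_mul, hG, mul_pow]
    have hqE : (q : E) ≠ 0 := by exact_mod_cast Fintype.card_ne_zero
    rw [hsum, hGn, hm2, map_div₀, map_pow, map_natCast, map_intCast, hm, pow_add]
    push_cast
    have hqm : (q : E) ^ m * ((q : E) ^ m)⁻¹ = 1 := mul_inv_cancel₀ (pow_ne_zero _ hqE)
    rw [div_eq_mul_inv]
    linear_combination (1 - (q : E)) * (quadraticChar k (-1) : E) ^ m *
      (quadraticChar k (∏ j, w j) : E) * (q : E) ^ m * hqm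
  · have hsum : ∑ c ∈ Finset.univ.erase (0 : k), (quadraticChar k c : E) ^ n = 0 := by
      have hodd := Nat.not_even_iff_odd.mp hn
      have h0 : ∑ c : k, (quadraticChar k c : E) = 0 := by
        rw [← Int.cast_sum, quadraticChar_sum_zero hk, Int.cast_zero]
      rw [← Finset.add_sum_erase _ _ (Finset.mem_univ (0 : k)), MulChar.map_zero, Int.cast_zero,
        zero_add] at h0
      rw [← h0]
      refine Finset.sum_congr rfl fun c hc => ?_
      rcases quadraticChar_dichotomy (Finset.ne_of_mem_erase hc) with h | h <;> rw [h]
      · simp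
      · rw [Int.cast_neg, Int.cast_one, hodd.neg_one_pow]
    rw [hsum]
    simp

end Counting

end

noncomputable section

/-! ### Diagonal quadratic forms over a discrete valuation ring -/

section ScaleHom

variable {R : Type*} [CommRing R] {ι : Type*}

/-- The exponents of the diagonal form obtained by replacing `x_j` by `ϖ x_j` whenever `e j = 0`,
and dividing by `ϖ`. -/
def shiftExp (e : ι → ℕ) (j : ι) : ℕ := if e j = 0 then 1 else e j - 1

/-- Multiplication by `ϖ` of those coordinates for which `e j = 0`. -/
def scaleHom (ϖ : R) (e : ι → ℕ) : (ι → R) →+ (ι → R) where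
  toFun x j := if e j = 0 then ϖ * x j else x j
  map_zero' := by ext j; simp
  map_add' x y := by
    ext j
    simp only [Pi.add_apply]
    split_ifs <;> ring

theorem scaleHom_apply (ϖ : R) (e : ι → ℕ) (x : ι → R) (j : ι) :
    scaleHom ϖ e x j = if e j = 0 then ϖ * x j else x j := rfl

theorem scaleHom_injective [IsDomain R] {ϖ : R} (hϖ : ϖ ≠ 0) (e : ι → ℕ) :
    Function.Injective (scaleHom (R := R) ϖ e) := by
  intro x y hxy
  ext j
  have := congrFun hxy j
  simp only [scaleHom_apply] at this
  split_ifs at this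
  · exact mul_left_cancel₀ hϖ this
  · exact this

theorem range_scaleHom (ϖ : R) (e : ι → ℕ) :
    Set.range (scaleHom ϖ e) = Set.univ.pi fun j => if e j = 0 then {x | ϖ ∣ x} else Set.univ := by
  ext x
  simp only [Set.mem_range, Set.mem_univ_pi]
  constructor
  · rintro ⟨y, rfl⟩ j
    rw [scaleHom_apply]
    split_ifs with h
    · exact dvd_mul_right _ _
    · trivial
  · intro h
    have h' : ∀ j, ∃ y, x j = if e j = 0 then ϖ * y else y := by
      intro j
      have := h j
      split_ifs at this ⊢ with h0
      · exact this
      · exact ⟨x j, rfl⟩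
    choose y hy using h'
    exact ⟨y, funext fun j => (hy j).symm⟩

/-- The points whose coordinates with `e j = 0` have prescribed residues. -/
def residueClass [IsLocalRing R] (e : ι → ℕ) (b : {j // e j = 0} → IsLocalRing.ResidueField R) :
    Set (ι → R) :=
  {x | ∀ j : {j // e j = 0}, IsLocalRing.residue R (x j) = b j}

/-- Translation by a lift of the residues carries every class to the zero class, so all classes have
the same measure. -/
theorem residueClass_eq_preimage [IsLocalRing R] (e : ι → ℕ)
    (b : {j // e j = 0} → IsLocalRing.ResidueField R) :
    ∃ v : ι → R, residueClass e b = (fun x => x + v) ⁻¹' residueClass (R := R) e 0 := by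
  classical
  choose l hl using IsLocalRing.residue_surjective (R := R)
  refine ⟨fun j => if h : e j = 0 then -l (b ⟨j, h⟩) else 0, ?_⟩
  ext x
  simp only [residueClass, Set.mem_preimage, Set.mem_ofPred_eq]
  refine forall_congr' fun j => ?_
  simp only [Pi.add_apply, j.2, dif_pos, map_add, map_neg, hl, Pi.zero_apply]
  rw [← sub_eq_add_neg, sub_eq_zero]

end ScaleHom

section DiagonalForm

variable {R : Type*} [CommRing R] {ι : Type*} [Fintype ι]

/-- The diagonal quadratic form `∑ ϖ ^ (e j) u_j x_j ^ 2`. -/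
def diagForm (ϖ : R) (u : ι → R) (e : ι → ℕ) (x : ι → R) : R :=
  ∑ j, ϖ ^ e j * u j * x j ^ 2

/-- A rescaled variable gains `ϖ ^ 2`; after one factor `ϖ` is taken out of the whole form, exponent
0 becomes 1 and every other exponent drops by 1. This is the origin of `shiftExp`. -/
theorem diagForm_scaleHom (ϖ : R) (u : ι → R) (e : ι → ℕ) (x : ι → R) :
    diagForm ϖ u e (scaleHom ϖ e x) = ϖ * diagForm ϖ u (shiftExp e) x := by
  simp only [diagForm, Finset.mul_sum]
  refine Finset.sum_congr rfl fun j _ => ?_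
  rw [scaleHom_apply, shiftExp]
  split_ifs with h
  · rw [h]; ring
  · obtain ⟨m, hm⟩ := Nat.exists_eq_succ_of_ne_zero h
    rw [hm, Nat.succ_sub_one, pow_succ]; ring

theorem diagForm_add_single [DecidableEq ι] (ϖ : R) (u : ι → R) (e : ι → ℕ) (x : ι → R) {j : ι}
    (hj : e j = 0) (s : R) :
    diagForm ϖ u e (x + Pi.single j s) =
      diagForm ϖ u e x + u j * (2 * x j * s + s ^ 2) := by
  have h : diagForm ϖ u e (x + Pi.single j s) - diagForm ϖ u e x =
      u j * (2 * x j * s + s ^ 2) := by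
    rw [diagForm, diagForm, ← Finset.sum_sub_distrib, Finset.sum_eq_single j]
    · simp only [Pi.add_apply, Pi.single_eq_same, hj]
      ring
    · intro i _ hi
      simp [Pi.single_eq_of_ne hi]
    · simp
  rw [← h]
  ring

theorem continuous_diagForm [TopologicalSpace R] [IsTopologicalRing R] (ϖ : R) (u : ι → R)
    (e : ι → ℕ) : Continuous (diagForm ϖ u e) := by
  unfold diagForm; fun_prop

end DiagonalForm

section DiscreteValuationRing

variable {R : Type*} [CommRing R] [IsDomain R] [IsDiscreteValuationRing R] {ι : Type*}

theorem residue_eq_zero_iff_dvd {ϖ : R} (hϖ : Irreducible ϖ) (x : R) :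
    IsLocalRing.residue R x = 0 ↔ ϖ ∣ x := by
  rw [IsLocalRing.residue_eq_zero_iff, hϖ.maximalIdeal_eq, Ideal.mem_span_singleton]

theorem residueCard_pos [Finite (IsLocalRing.ResidueField R)] : 0 < residueCard R := Nat.card_pos

theorem residueClass_zero {ϖ : R} (hϖ : Irreducible ϖ) (e : ι → ℕ) :
    residueClass e 0 = Set.range (scaleHom ϖ e) := by
  rw [range_scaleHom]
  ext x
  simp only [residueClass, Set.mem_ofPred_eq, Subtype.forall, Pi.zero_apply, Set.mem_univ_pi]
  refine forall_congr' fun j => ?_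
  split_ifs with h
  · simp only [h, forall_const, Set.mem_ofPred_eq]
    exact residue_eq_zero_iff_dvd hϖ _
  · simp [h]

theorem residue_diagForm [Fintype ι] {ϖ : R} (hϖ : Irreducible ϖ) (u : ι → R) (e : ι → ℕ)
    {b : {j // e j = 0} → IsLocalRing.ResidueField R} {x : ι → R} (hx : x ∈ residueClass e b) :
    IsLocalRing.residue R (diagForm ϖ u e x) =
      ∑ j : {j // e j = 0}, IsLocalRing.residue R (u j) * b j ^ 2 := by
  have h0 : IsLocalRing.residue R ϖ = 0 := (residue_eq_zero_iff_dvd hϖ ϖ).mpr dvd_rfl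
  have h1 : ∀ j, IsLocalRing.residue R (ϖ ^ e j * u j * x j ^ 2) =
      if e j = 0 then IsLocalRing.residue R (u j) * IsLocalRing.residue R (x j) ^ 2 else 0 := by
    intro j
    rw [map_mul, map_mul, map_pow, map_pow, h0]
    split_ifs with h
    · rw [h, pow_zero, one_mul]
    · rw [zero_pow h, zero_mul, zero_mul]
  rw [diagForm, map_sum, Finset.sum_congr rfl fun j _ => h1 j, ← Finset.sum_filter,
    Finset.sum_subtype (p := fun j => e j = 0) _ (by simp)]
  exact Finset.sum_congr rfl fun j _ => by rw [hx j]

theorem residueClass_add_single [DecidableEq ι] {ϖ : R} (hϖ : Irreducible ϖ) {e : ι → ℕ}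
    {b : {j // e j = 0} → IsLocalRing.ResidueField R} {x : ι → R} (j : ι) (k : ℕ) (c : R) :
    x + Pi.single j (ϖ ^ (k + 1) * c) ∈ residueClass e b ↔ x ∈ residueClass e b := by
  have h0 : IsLocalRing.residue R ϖ = 0 := (residue_eq_zero_iff_dvd hϖ ϖ).mpr dvd_rfl
  refine forall_congr' fun i => ?_
  have : IsLocalRing.residue R ((Pi.single j (ϖ ^ (k + 1) * c) : ι → R) i) = 0 := by
    by_cases hij : (i : ι) = j
    · rw [hij, Pi.single_eq_same, map_mul, map_pow, h0, zero_pow k.succ_ne_zero, zero_mul]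
    · rw [Pi.single_eq_of_ne hij, map_zero]
  rw [Pi.add_apply, map_add, this, add_zero]

/-- Among the translates of a solution of `F ≡ 0` modulo `ϖ ^ (k + 1)` that is smooth in the
direction `j`, by multiples of `ϖ ^ (k + 1)` in that direction, exactly one class solves
`F ≡ 0` modulo `ϖ ^ (k + 2)`. -/
theorem dvd_diagForm_add_single_iff [Fintype ι] [DecidableEq ι] {ϖ : R} (hϖ : Irreducible ϖ)
    (h2 : IsUnit (2 : R)) {u : ι → R} {e : ι → ℕ} {x : ι → R} {j : ι} (hj : e j = 0)
    (hu : IsUnit (u j)) (hx : IsLocalRing.residue R (x j) ≠ 0) {k : ℕ} {m : R}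
    (hm : diagForm ϖ u e x = ϖ ^ (k + 1) * m) (c : R) :
    ϖ ^ (k + 2) ∣ diagForm ϖ u e (x + Pi.single j (ϖ ^ (k + 1) * c)) ↔
      IsLocalRing.residue R c =
        -IsLocalRing.residue R m / IsLocalRing.residue R (u j * (2 * x j)) := by
  have h0 : IsLocalRing.residue R ϖ = 0 := (residue_eq_zero_iff_dvd hϖ ϖ).mpr dvd_rfl
  have hne : IsLocalRing.residue R (u j * (2 * x j)) ≠ 0 := by
    rw [map_mul, map_mul]
    exact mul_ne_zero (hu.map _).ne_zero (mul_ne_zero (h2.map _).ne_zero hx)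
  have heq : diagForm ϖ u e x + u j * (2 * x j * (ϖ ^ (k + 1) * c) + (ϖ ^ (k + 1) * c) ^ 2) =
      ϖ ^ (k + 1) * (m + u j * (2 * x j) * c + ϖ ^ (k + 1) * (u j * c ^ 2)) := by
    rw [hm]; ring
  rw [diagForm_add_single ϖ u e x hj, heq, pow_succ ϖ (k + 1),
    mul_dvd_mul_iff_left (pow_ne_zero _ hϖ.ne_zero), ← residue_eq_zero_iff_dvd hϖ, map_add, map_add,
    map_mul _ (ϖ ^ (k + 1)), map_pow, h0, zero_pow k.succ_ne_zero, zero_mul, add_zero,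
    map_mul _ (u j * (2 * x j)), eq_div_iff hne, eq_neg_iff_add_eq_zero, add_comm, mul_comm]

end DiscreteValuationRing

/-! ### Haar measure on powers of a compact discrete valuation ring -/

section Haar

variable (R : Type*) [CommRing R] [TopologicalSpace R] [IsTopologicalRing R] [CompactSpace R]
  [MeasurableSpace R] [BorelSpace R]

/-- The Haar probability measure on `R ^ ι`. -/
def haarProb (ι : Type*) [Fintype ι] : Measure (ι → R) :=
  Measure.pi fun _ => Measure.addHaarMeasure (⊤ : TopologicalSpace.PositiveCompacts R)

instance : IsProbabilityMeasure
    (Measure.addHaarMeasure (⊤ : TopologicalSpace.PositiveCompacts R)) :=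
  ⟨Measure.addHaarMeasure_self⟩

instance (ι : Type*) [Fintype ι] : IsProbabilityMeasure (haarProb R ι) := by
  unfold haarProb; infer_instance

instance [SecondCountableTopology R] (ι : Type*) [Fintype ι] :
    (haarProb R ι).IsAddHaarMeasure := by
  unfold haarProb; infer_instance

variable {R}

theorem measurableSet_dvd [IsNoetherianRing R] [T2Space R] (a : R) :
    MeasurableSet {x : R | a ∣ x} := by
  have : {x : R | a ∣ x} = (Ideal.span {a} : Ideal R) := by
    ext x
    simp [Ideal.mem_span_singleton]
  rw [this]
  exact (IsNoetherianRing.isClosed_ideal _).measurableSet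

theorem measurableSet_residueClass [IsDomain R] [IsDiscreteValuationRing R] [T2Space R]
    {ι : Type*} [Countable ι] (e : ι → ℕ)
    (b : {j // e j = 0} → IsLocalRing.ResidueField R) :
    MeasurableSet (residueClass (R := R) e b) := by
  obtain ⟨ϖ, hϖ⟩ := IsDiscreteValuationRing.exists_irreducible R
  obtain ⟨v, hv⟩ := residueClass_eq_preimage (R := R) e b
  rw [hv, residueClass_zero hϖ, range_scaleHom]
  refine (measurable_add_const v) (MeasurableSet.univ_pi fun j => ?_)
  split_ifs
  · exact measurableSet_dvd ϖ
  · exact MeasurableSet.univ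

variable [T2Space R] [SecondCountableTopology R] {ι : Type*} [Fintype ι]

theorem measurableSet_dvd_diagForm [IsNoetherianRing R] (ϖ : R) (u : ι → R) (e : ι → ℕ) (a : R) :
    MeasurableSet {x | a ∣ diagForm ϖ u e x} :=
  (continuous_diagForm ϖ u e).measurable (measurableSet_dvd a)

variable [IsDomain R] [IsDiscreteValuationRing R] [Finite (IsLocalRing.ResidueField R)]

set_option linter.unusedSectionVars false in
theorem addHaarMeasure_dvd_uniformizer {ϖ : R} (hϖ : Irreducible ϖ) :
    Measure.addHaarMeasure (⊤ : TopologicalSpace.PositiveCompacts R) {x | ϖ ∣ x} =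
      (residueCard R : ENNReal)⁻¹ := by
  set I := IsLocalRing.maximalIdeal R
  have hI : {x : R | ϖ ∣ x} = (I.toAddSubgroup : Set R) := by
    ext x
    rw [Set.mem_ofPred_eq, ← residue_eq_zero_iff_dvd hϖ, IsLocalRing.residue_eq_zero_iff]
    rfl
  have hidx : I.toAddSubgroup.index = residueCard R := rfl
  have : I.toAddSubgroup.FiniteIndex := ⟨by rw [hidx]; exact residueCard_pos.ne'⟩
  have h := I.toAddSubgroup.index_mul_measure (hI ▸ measurableSet_dvd ϖ)
    (Measure.addHaarMeasure (⊤ : TopologicalSpace.PositiveCompacts R))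
  rw [hidx, measure_univ, ← hI, mul_comm] at h
  exact ENNReal.eq_inv_of_mul_eq_one_left h

theorem haarProb_range_scaleHom {ϖ : R} (hϖ : Irreducible ϖ) (e : ι → ℕ) :
    haarProb R ι (Set.range (scaleHom ϖ e)) =
      (residueCard R : ENNReal)⁻¹ ^ Fintype.card {j // e j = 0} := by
  rw [range_scaleHom, haarProb, Measure.pi_pi]
  have h : ∀ j, Measure.addHaarMeasure (⊤ : TopologicalSpace.PositiveCompacts R)
      (if e j = 0 then {x | ϖ ∣ x} else Set.univ) =
      if e j = 0 then (residueCard R : ENNReal)⁻¹ else 1 := by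
    intro j
    split_ifs
    · exact addHaarMeasure_dvd_uniformizer hϖ
    · exact measure_univ
  simp_rw [h]
  rw [Finset.prod_ite, Finset.prod_const, Finset.prod_const_one, mul_one, Fintype.card_subtype]

/-- The pullback of Haar measure along the injective scaling is again translation invariant, hence a
multiple of Haar measure. The multiple is read off from the whole space. -/
theorem haarProb_image_scaleHom {ϖ : R} (hϖ : Irreducible ϖ) (e : ι → ℕ) (S : Set (ι → R)) :
    haarProb R ι (scaleHom ϖ e '' S) =
      (residueCard R : ENNReal)⁻¹ ^ Fintype.card {j // e j = 0} * haarProb R ι S := by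
  have hcont : Continuous (scaleHom (R := R) ϖ e) := by
    refine continuous_pi fun j => ?_
    simp only [scaleHom_apply]
    split_ifs <;> fun_prop
  have hemb : MeasurableEmbedding (scaleHom (R := R) ϖ e) :=
    (hcont.isClosedEmbedding (scaleHom_injective hϖ.ne_zero e)).measurableEmbedding
  have := Measure.IsAddLeftInvariant.comap (haarProb R ι) hemb
  have hfin : IsFiniteMeasure ((haarProb R ι).comap (scaleHom ϖ e)) :=
    ⟨by rw [hemb.comap_apply]; exact measure_lt_top _ _⟩
  have heq := Measure.isAddInvariant_eq_smul_of_compactSpace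
    ((haarProb R ι).comap (scaleHom ϖ e)) (haarProb R ι)
  set c := Measure.addHaarScalarFactor ((haarProb R ι).comap (scaleHom ϖ e)) (haarProb R ι)
  have h1 : ∀ T, haarProb R ι (scaleHom ϖ e '' T) = c * haarProb R ι T := by
    intro T
    rw [← hemb.comap_apply, heq]
    rfl
  have h2 := h1 Set.univ
  rw [measure_univ, mul_one, Set.image_univ, haarProb_range_scaleHom hϖ] at h2
  rw [h1, ← h2]

theorem haarProb_residueClass (e : ι → ℕ) (b : {j // e j = 0} → IsLocalRing.ResidueField R) :
    haarProb R ι (residueClass e b) =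
      (residueCard R : ENNReal)⁻¹ ^ Fintype.card {j // e j = 0} := by
  obtain ⟨ϖ, hϖ⟩ := IsDiscreteValuationRing.exists_irreducible R
  obtain ⟨v, hv⟩ := residueClass_eq_preimage (R := R) e b
  rw [hv, measure_preimage_add_right, residueClass_zero hϖ, haarProb_range_scaleHom hϖ]

theorem haarProb_residueClass_zero_inter {ϖ : R} (hϖ : Irreducible ϖ) (u : ι → R) (e : ι → ℕ)
    (k : ℕ) :
    haarProb R ι (residueClass e 0 ∩ {x | ϖ ^ (k + 1) ∣ diagForm ϖ u e x}) =
      (residueCard R : ENNReal)⁻¹ ^ Fintype.card {j // e j = 0} *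
        haarProb R ι {x | ϖ ^ k ∣ diagForm ϖ u (shiftExp e) x} := by
  rw [← haarProb_image_scaleHom hϖ e, residueClass_zero hϖ]
  congr 1
  ext x
  simp only [Set.mem_inter_iff, Set.mem_range, Set.mem_ofPred_eq, Set.mem_image]
  constructor
  · rintro ⟨⟨y, rfl⟩, h⟩
    refine ⟨y, ?_, rfl⟩
    rwa [diagForm_scaleHom, pow_succ', mul_dvd_mul_iff_left hϖ.ne_zero] at h
  · rintro ⟨y, h, rfl⟩
    refine ⟨⟨y, rfl⟩, ?_⟩
    rwa [diagForm_scaleHom, pow_succ', mul_dvd_mul_iff_left hϖ.ne_zero]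

/-- Hensel lifting in measure form. Along a coordinate `j` with `b j ≠ 0`, each solution modulo `ϖ ^
(k + 1)` has exactly one correction class, indexed by the residue field, that makes it a solution
modulo `ϖ ^ (k + 2)`. The solution set is therefore a disjoint union of `q` translates of the finer
one. -/
theorem haarProb_residueClass_inter_succ {ϖ : R} (hϖ : Irreducible ϖ) (h2 : IsUnit (2 : R))
    {u : ι → R} (hu : ∀ j, IsUnit (u j)) (e : ι → ℕ)
    {b : {j // e j = 0} → IsLocalRing.ResidueField R} (hb : b ≠ 0) (k : ℕ) :
    haarProb R ι (residueClass e b ∩ {x | ϖ ^ (k + 1) ∣ diagForm ϖ u e x}) =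
      residueCard R *
        haarProb R ι (residueClass e b ∩ {x | ϖ ^ (k + 2) ∣ diagForm ϖ u e x}) := by
  classical
  have := Fintype.ofFinite (IsLocalRing.ResidueField R)
  obtain ⟨⟨j, hj⟩, hbj⟩ := Function.ne_iff.mp hb
  choose l hl using IsLocalRing.residue_surjective (R := R)
  set T := residueClass e b ∩ {x | ϖ ^ (k + 2) ∣ diagForm ϖ u e x} with hT
  have hTm : MeasurableSet T :=
    (measurableSet_residueClass e b).inter (measurableSet_dvd_diagForm ϖ u e _)
  set f : IsLocalRing.ResidueField R → Set (ι → R) :=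
    fun c => (fun x => x + Pi.single j (ϖ ^ (k + 1) * l c)) ⁻¹' T with hf
  have hunion : residueClass e b ∩ {x | ϖ ^ (k + 1) ∣ diagForm ϖ u e x} =
      ⋃ c ∈ Finset.univ, f c := by
    ext x
    simp only [Finset.mem_univ, Set.iUnion_true, Set.mem_iUnion, hf, hT, Set.mem_preimage,
      Set.mem_inter_iff, residueClass_add_single hϖ, Set.mem_ofPred_eq]
    constructor
    · rintro ⟨hx, m, hm⟩
      have hxj : IsLocalRing.residue R (x j) ≠ 0 := by rw [hx ⟨j, hj⟩]; exact hbj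
      refine ⟨_, hx, (dvd_diagForm_add_single_iff hϖ h2 hj (hu j) hxj hm _).mpr (hl _)⟩
    · rintro ⟨c, hx, h⟩
      refine ⟨hx, ?_⟩
      have h' := (pow_dvd_pow ϖ (Nat.le_succ (k + 1))).trans h
      rw [diagForm_add_single ϖ u e x hj] at h'
      refine (dvd_add_left ?_).mp h'
      exact ⟨u j * (2 * x j * l c + ϖ ^ (k + 1) * l c ^ 2), by ring⟩
  have hdisj : (↑(Finset.univ : Finset (IsLocalRing.ResidueField R)) : Set _).PairwiseDisjoint f := by
    intro c _ c' _ hcc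
    refine Set.disjoint_left.mpr fun x hx hx' => hcc ?_
    have hxU : x ∈ residueClass e b ∩ {x | ϖ ^ (k + 1) ∣ diagForm ϖ u e x} := by
      rw [hunion]
      exact Set.mem_biUnion (Finset.mem_univ c) hx
    obtain ⟨hxb, m, hm⟩ := hxU
    have hxj : IsLocalRing.residue R (x j) ≠ 0 := by rw [hxb ⟨j, hj⟩]; exact hbj
    rw [← hl c, ← hl c', (dvd_diagForm_add_single_iff hϖ h2 hj (hu j) hxj hm _).mp hx.2,
      (dvd_diagForm_add_single_iff hϖ h2 hj (hu j) hxj hm _).mp hx'.2]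
  rw [hunion, measure_biUnion_finset hdisj fun c _ => (measurable_add_const _) hTm]
  simp only [hf, measure_preimage_add_right]
  rw [Finset.sum_const, Finset.card_univ, nsmul_eq_mul, residueCard, Nat.card_eq_fintype_card]

open Classical in
theorem haarProb_residueClass_inter {ϖ : R} (hϖ : Irreducible ϖ) (h2 : IsUnit (2 : R))
    {u : ι → R} (hu : ∀ j, IsUnit (u j)) (e : ι → ℕ)
    {b : {j // e j = 0} → IsLocalRing.ResidueField R} (hb : b ≠ 0) (k : ℕ) :
    haarProb R ι (residueClass e b ∩ {x | ϖ ^ (k + 1) ∣ diagForm ϖ u e x}) =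
      if ∑ j : {j // e j = 0}, IsLocalRing.residue R (u j) * b j ^ 2 = 0 then
        (residueCard R : ENNReal)⁻¹ ^ Fintype.card {j // e j = 0} * (residueCard R : ENNReal)⁻¹ ^ k
      else 0 := by
  induction k with
  | zero =>
    rw [zero_add, pow_one, pow_zero, mul_one]
    split_ifs with h
    · rw [← haarProb_residueClass e b]
      congr 1
      ext x
      simp only [Set.mem_inter_iff, Set.mem_ofPred_eq, and_iff_left_iff_imp]
      intro hx
      rwa [← residue_eq_zero_iff_dvd hϖ, residue_diagForm hϖ u e hx]
    · convert measure_empty (μ := haarProb R ι)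
      ext x
      simp only [Set.mem_inter_iff, Set.mem_ofPred_eq, Set.mem_empty_iff_false, iff_false, not_and]
      intro hx
      rwa [← residue_eq_zero_iff_dvd hϖ, residue_diagForm hϖ u e hx]
  | succ k ih =>
    have hq0 : (residueCard R : ENNReal) ≠ 0 := by exact_mod_cast residueCard_pos.ne'
    have hq1 : (residueCard R : ENNReal) ≠ ⊤ := ENNReal.natCast_ne_top _
    rw [haarProb_residueClass_inter_succ hϖ h2 hu e hb k] at ih
    have := congrArg (fun y => (residueCard R : ENNReal)⁻¹ * y) ih
    simp only [← mul_assoc, ENNReal.inv_mul_cancel hq0 hq1, one_mul] at this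
    rw [this]
    split_ifs
    · rw [pow_succ]; ring
    · rw [mul_zero]

open Classical in
/-- The number of nonzero zeros of the reduction of the form `∑ u_j x_j ^ 2`, where the sum is over
all `j` with `p j`. -/
def isotropicCard (u : ι → R) (p : ι → Prop) : ℕ :=
  Nat.card {b : {j // p j} → IsLocalRing.ResidueField R //
    b ≠ 0 ∧ ∑ j : {j // p j}, IsLocalRing.residue R (u j) * b j ^ 2 = 0}

/-- The basic recursion: points are sorted by the residues of the variables with exponent 0. The
first summand collects the smooth isotropic classes, the second the class of the zero vector after
rescaling. -/
theorem haarProb_dvd_diagForm_succ {ϖ : R} (hϖ : Irreducible ϖ) (h2 : IsUnit (2 : R))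
    {u : ι → R} (hu : ∀ j, IsUnit (u j)) (e : ι → ℕ) (k : ℕ) :
    haarProb R ι {x | ϖ ^ (k + 1) ∣ diagForm ϖ u e x} =
      (residueCard R : ENNReal)⁻¹ ^ Fintype.card {j // e j = 0} *
      (isotropicCard u (fun j => e j = 0) * (residueCard R : ENNReal)⁻¹ ^ k +
        haarProb R ι {x | ϖ ^ k ∣ diagForm ϖ u (shiftExp e) x}) := by
  classical
  have := Fintype.ofFinite (IsLocalRing.ResidueField R)
  set f : ({j // e j = 0} → IsLocalRing.ResidueField R) → Set (ι → R) :=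
    fun b => residueClass e b ∩ {x | ϖ ^ (k + 1) ∣ diagForm ϖ u e x} with hf
  have hunion : {x | ϖ ^ (k + 1) ∣ diagForm ϖ u e x} = ⋃ b ∈ Finset.univ, f b := by
    ext x
    simp only [Finset.mem_univ, Set.iUnion_true, Set.mem_iUnion, hf, Set.mem_inter_iff]
    exact ⟨fun h => ⟨fun j => IsLocalRing.residue R (x j), fun _ => rfl, h⟩, fun ⟨_, _, h⟩ => h⟩
  have hdisj : (↑(Finset.univ : Finset ({j // e j = 0} → IsLocalRing.ResidueField R)) :
      Set _).PairwiseDisjoint f := by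
    intro c _ c' _ hcc
    refine Set.disjoint_left.mpr fun x hx hx' => hcc ?_
    ext j
    rw [← hx.1 j, ← hx'.1 j]
  rw [hunion, measure_biUnion_finset hdisj fun c _ =>
    (measurableSet_residueClass e c).inter (measurableSet_dvd_diagForm ϖ u e _),
    ← Finset.add_sum_erase _ _ (Finset.mem_univ 0), hf,
    haarProb_residueClass_zero_inter hϖ, mul_add, add_comm]
  congr 1
  rw [Finset.sum_congr rfl fun b hb =>
    haarProb_residueClass_inter hϖ h2 hu e (Finset.ne_of_mem_erase hb) k, ← Finset.sum_filter,
    Finset.sum_const, nsmul_eq_mul, mul_left_comm]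
  congr 2
  rw [isotropicCard, Nat.card_eq_fintype_card, Fintype.card_subtype]
  refine congrArg (fun s : Finset _ => (s.card : ENNReal)) (Finset.ext fun b => ?_)
  simp only [Finset.mem_filter, Finset.mem_erase, Finset.mem_univ, and_true, true_and, ne_eq]
  convert Iff.rfl

end Haar

end

noncomputable section

/-! ### The zeta integral as a power series -/

section ZetaSeries

variable {R : Type*} [CommRing R] [IsDomain R] [IsDiscreteValuationRing R]

theorem one_lt_residueCard [Finite (IsLocalRing.ResidueField R)] : 1 < residueCard R :=
  Finite.one_lt_card

theorem pow_dvd_iff_le_addVal {ϖ : R} (hϖ : Irreducible ϖ) {a : R} (ha : a ≠ 0) (k : ℕ) :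
    ϖ ^ k ∣ a ↔ k ≤ (IsDiscreteValuationRing.addVal R a).toNat := by
  rw [← IsDiscreteValuationRing.addVal_le_iff_dvd, IsDiscreteValuationRing.addVal_pow,
    IsDiscreteValuationRing.addVal_uniformizer hϖ, nsmul_one,
    ← ENat.natCast_le_natCast, ENat.natCast_toNat]
  · rwa [ne_eq, IsDiscreteValuationRing.addVal_eq_top_iff]

theorem normalizedAbs_cpow_of_ne_zero {a : R} (ha : a ≠ 0) (s : ℂ) :
    ((normalizedAbs a : ℝ) : ℂ) ^ s =
      ((residueCard R : ℂ) ^ (-s)) ^ (IsDiscreteValuationRing.addVal R a).toNat := by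
  have hinv : (((residueCard R : ℝ)⁻¹ : ℝ) : ℂ) ^ s = (residueCard R : ℂ) ^ (-s) := by
    rw [Complex.ofReal_inv, Complex.ofReal_natCast, Complex.inv_cpow, Complex.cpow_neg]
    rw [Complex.natCast_arg]
    exact Real.pi_pos.ne
  -- Complex powers are multiplicative here because the bases are nonnegative reals, so no branch of
  -- the logarithm intervenes.
  have hpow : ∀ m : ℕ, ((((residueCard R : ℝ)⁻¹) ^ m : ℝ) : ℂ) ^ s =
      ((residueCard R : ℂ) ^ (-s)) ^ m := by
    intro m
    induction m with
    | zero => simp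
    | succ m ih =>
      rw [pow_succ, Complex.ofReal_mul, Complex.mul_cpow_ofReal_nonneg (by positivity)
        (by positivity), ih, hinv, pow_succ]
  rw [normalizedAbs, if_neg ha, zpow_neg, zpow_natCast, ← inv_pow, hpow]

theorem norm_residueCard_cpow_lt_one [Finite (IsLocalRing.ResidueField R)] {s : ℂ}
    (hs : 0 < s.re) : ‖(residueCard R : ℂ) ^ (-s)‖ < 1 := by
  rw [Complex.norm_natCast_cpow_of_pos residueCard_pos, Complex.neg_re]
  exact Real.rpow_lt_one_of_one_lt_of_neg (by exact_mod_cast one_lt_residueCard) (by linarith)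

variable {X : Type*} [MeasurableSpace X] {μ : Measure X} [IsProbabilityMeasure μ]

/-- The integral of `|F| ^ s` is a power series in `q ^ (-s)`, whose coefficients are the measures
of the level sets of the valuation of `F`. -/
theorem hasSum_integral_normalizedAbs_cpow [Finite (IsLocalRing.ResidueField R)] {ϖ : R}
    (hϖ : Irreducible ϖ) {F : X → R} (hF : ∀ k : ℕ, MeasurableSet {x | ϖ ^ k ∣ F x}) {s : ℂ}
    (hs : 0 < s.re) :
    Integrable (fun x => ((normalizedAbs (F x) : ℝ) : ℂ) ^ s) μ ∧
    HasSum (fun k : ℕ => ((μ.real {x | ϖ ^ k ∣ F x} - μ.real {x | ϖ ^ (k + 1) ∣ F x} : ℝ) : ℂ) *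
      ((residueCard R : ℂ) ^ (-s)) ^ k) (∫ x, ((normalizedAbs (F x) : ℝ) : ℂ) ^ s ∂μ) := by
  set t : ℂ := (residueCard R : ℂ) ^ (-s) with ht
  have ht1 : ‖t‖ < 1 := norm_residueCard_cpow_lt_one hs
  have hs0 : s ≠ 0 := by rintro rfl; simp at hs
  set D : ℕ → Set X := fun k => {x | ϖ ^ k ∣ F x} \ {x | ϖ ^ (k + 1) ∣ F x} with hD
  have hDm : ∀ k, MeasurableSet (D k) := fun k => (hF k).diff (hF (k + 1))
  have hDμ : ∀ k, μ.real (D k) = μ.real {x | ϖ ^ k ∣ F x} - μ.real {x | ϖ ^ (k + 1) ∣ F x} :=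
    fun k => measureReal_sdiff (fun x hx => (pow_dvd_pow ϖ k.le_succ).trans hx) (hF (k + 1))
  set f : ℕ → X → ℂ := fun k => (D k).indicator fun _ => t ^ k with hf
  have hsum : ∀ x, HasSum (fun k => f k x) (((normalizedAbs (F x) : ℝ) : ℂ) ^ s) := by
    intro x
    by_cases hx : F x = 0
    -- A zero of `F` lies in no level set, and `0 ^ s = 0` since `s ≠ 0`. The expansion thus holds
    -- at every point, and the zero set need not be shown to be null.
    · have h0 : ∀ k, f k x = 0 := fun k => by
        rw [hf]
        exact Set.indicator_of_notMem (fun h => h.2 (by simp [hx])) _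
      rw [hx, normalizedAbs, if_pos rfl, Complex.ofReal_zero, Complex.zero_cpow hs0]
      simp_rw [h0]
      exact hasSum_zero
    · set v := (IsDiscreteValuationRing.addVal R (F x)).toNat
      have hmem : ∀ k, x ∈ D k ↔ k = v := by
        intro k
        simp only [hD, Set.mem_sdiff, Set.mem_ofPred_eq, pow_dvd_iff_le_addVal hϖ hx]
        omega
      rw [normalizedAbs_cpow_of_ne_zero hx]
      have hv : f v x = t ^ v := by
        rw [hf]
        exact Set.indicator_of_mem ((hmem v).mpr rfl) _
      rw [← hv]
      refine hasSum_single v fun k hk => ?_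
      rw [hf]
      exact Set.indicator_of_notMem (fun h => hk ((hmem k).mp h)) _
  have hfi : ∀ k, Integrable (f k) μ := fun k => (integrable_const (t ^ k)).indicator (hDm k)
  have hmeas : Measurable fun x => ((normalizedAbs (F x) : ℝ) : ℂ) ^ s := by
    refine measurable_of_tendsto_metrizable
      (f := fun n x => ∑ k ∈ Finset.range n, f k x)
      (fun n => Finset.measurable_fun_sum _ fun k _ => measurable_const.indicator (hDm k)) ?_
    exact tendsto_pi_nhds.mpr fun x => (hsum x).tendsto_sum_nat
  refine ⟨?_, ?_⟩
  · refine Integrable.of_bound hmeas.aestronglyMeasurable 1 (Filter.Eventually.of_forall fun x => ?_)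
    by_cases hx : F x = 0
    · rw [hx, normalizedAbs, if_pos rfl, Complex.ofReal_zero, Complex.zero_cpow hs0, norm_zero]
      exact zero_le_one
    · rw [normalizedAbs_cpow_of_ne_zero hx, norm_pow]
      exact pow_le_one₀ (norm_nonneg _) ht1.le
  · have hint : ∀ k, ∫ x, f k x ∂μ =
        ((μ.real {x | ϖ ^ k ∣ F x} - μ.real {x | ϖ ^ (k + 1) ∣ F x} : ℝ) : ℂ) * t ^ k := by
      intro k
      rw [hf, integral_indicator_const _ (hDm k), hDμ, Complex.real_smul]
    have hnorm : Summable fun k => ∫ x, ‖f k x‖ ∂μ := by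
      refine Summable.of_nonneg_of_le (fun k => integral_nonneg fun x => norm_nonneg _)
        (fun k => ?_) (summable_geometric_of_lt_one (norm_nonneg t) ht1)
      have : ∀ x, ‖f k x‖ ≤ ‖t‖ ^ k := fun x => by
        rw [hf, ← norm_pow]
        exact norm_indicator_le_norm_self (fun _ => t ^ k) x
      calc ∫ x, ‖f k x‖ ∂μ ≤ ∫ _, ‖t‖ ^ k ∂μ :=
            integral_mono (hfi k).norm (integrable_const _) this
        _ = ‖t‖ ^ k := by simp
    have := hasSum_integral_of_summable_integral_norm hfi hnorm
    simp_rw [hint, fun x => (hsum x).tsum_eq] at this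
    exact this

/-- The power series `∑ (a_k - a_{k+1}) t ^ k`. -/
def differenceSeries (a : ℕ → ℝ) (t : ℂ) : ℂ := ∑' k, ((a k - a (k + 1) : ℝ) : ℂ) * t ^ k

theorem summable_differenceSeries {a : ℕ → ℝ} (h0 : ∀ k, 0 ≤ a k) (h1 : ∀ k, a k ≤ 1) {t : ℂ}
    (ht : ‖t‖ < 1) : Summable fun k => ((a k - a (k + 1) : ℝ) : ℂ) * t ^ k := by
  refine Summable.of_norm_bounded (summable_geometric_of_lt_one (norm_nonneg t) ht) fun k => ?_
  rw [norm_mul, norm_pow, Complex.norm_real]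
  refine mul_le_of_le_one_left (by positivity) ?_
  rw [Real.norm_eq_abs, abs_le]
  constructor <;> linarith [h0 k, h1 k, h0 (k + 1), h1 (k + 1)]

/-- The recursion for measures in terms of generating functions. The term `k = 0` is `1 - c (N +
1)`; the remaining ones are `t` times a geometric series in `t / q` plus `c t` times the series of
`b`. -/
theorem differenceSeries_eq {a b : ℕ → ℝ} (hb0 : ∀ k, 0 ≤ b k) (hb1 : ∀ k, b k ≤ 1)
    (ha : a 0 = 1) (hb : b 0 = 1) {q c N : ℝ} (hq : 1 < q)
    (hab : ∀ k, a (k + 1) = c * (N * q⁻¹ ^ k + b k)) {t : ℂ} (ht : ‖t‖ < 1) :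
    differenceSeries a t = (1 - c - c * N) + c * N * (1 - (q : ℂ)⁻¹) * t / (1 - t / q) +
      c * t * differenceSeries b t := by
  have hq0 : (q : ℂ) ≠ 0 := by exact_mod_cast (by linarith : q ≠ 0)
  have hr : ‖t / q‖ < 1 := by
    rw [norm_div, Complex.norm_real, Real.norm_of_nonneg (by linarith), div_lt_one (by linarith)]
    linarith
  have hgeo := (hasSum_geometric_of_norm_lt_one hr).mul_left (c * N * (1 - (q : ℂ)⁻¹) * t)
  have hser := (summable_differenceSeries hb0 hb1 ht).hasSum.mul_left (c * t)
  have h := hgeo.add hser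
  have hterm : ∀ k : ℕ, c * N * (1 - (q : ℂ)⁻¹) * t * (t / q) ^ k +
      c * t * (((b k - b (k + 1) : ℝ) : ℂ) * t ^ k) =
      ((a (k + 1) - a (k + 1 + 1) : ℝ) : ℂ) * t ^ (k + 1) := by
    intro k
    rw [hab, hab]
    push_cast
    rw [div_pow, div_eq_mul_inv, ← inv_pow]
    ring
  simp_rw [hterm] at h
  have h' := (hasSum_nat_add_iff' (f := fun k => ((a k - a (k + 1) : ℝ) : ℂ) * t ^ k) 1
    (g := (1 - c - c * N) + c * N * (1 - (q : ℂ)⁻¹) * t / (1 - t / q) +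
      c * t * differenceSeries b t)).mp ?_
  · exact h'.tsum_eq
  · rw [Finset.sum_range_one, ha, hab 0, hb]
    refine (congrArg (HasSum _) ?_).mp h
    rw [differenceSeries]
    push_cast
    ring

end ZetaSeries

end

noncomputable section

/-! ### Rational functions on the unit disc -/

section Fractions

/-- The function `Z` on the open unit disc is the rational function `f / g`. -/
def EqFractionOnDisc (Z : ℂ → ℂ) (f g : ℚ[X]) : Prop :=
  ∀ t : ℂ, ‖t‖ < 1 → Z t * aeval t g = aeval t f

theorem EqFractionOnDisc.cancel {Z : ℂ → ℂ} {f g w : ℚ[X]} (h : EqFractionOnDisc Z (f * w) (g * w))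
    (hw : ∀ t : ℂ, ‖t‖ < 1 → aeval t w ≠ 0) : EqFractionOnDisc Z f g := by
  intro t ht
  have := h t ht
  rw [map_mul, map_mul, ← mul_assoc] at this
  exact mul_right_cancel₀ (hw t ht) this

/-- `Z` takes a finite value at every point of the disc, so a zero of `g` there would also be a zero
of `f`, against Bézout. -/
theorem EqFractionOnDisc.aeval_denom_ne_zero {Z : ℂ → ℂ} {f g : ℚ[X]}
    (h : EqFractionOnDisc Z f g) (hfg : IsCoprime f g) {t : ℂ} (ht : ‖t‖ < 1) :
    aeval t g ≠ 0 := by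
  intro hg
  have hf := h t ht
  rw [hg, mul_zero] at hf
  obtain ⟨a, b, hab⟩ := hfg
  have := congrArg (aeval t) hab
  simp [hg, ← hf] at this

theorem isCoprime_C {z : ℚ} (hz : z ≠ 0) (h : ℚ[X]) : IsCoprime (C z) h :=
  ⟨C z⁻¹, 0, by rw [← C_mul, inv_mul_cancel₀ hz, C_1, zero_mul, add_zero]⟩

theorem isCoprime_X_of_coeff_zero {h : ℚ[X]} (h0 : h.coeff 0 = 1) : IsCoprime X h := by
  refine ⟨-h.divX, 1, ?_⟩
  have h1 := divX_mul_X_add h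
  rw [h0, C_1] at h1
  linear_combination -h1

theorem IsCoprime.self_add_left {f h : ℚ[X]} (hf : IsCoprime f h) : IsCoprime (h + f) h := by
  simpa [add_comm] using hf.add_mul_left_left 1

theorem isCoprime_X_sub_C_of_eval_ne_zero {h : ℚ[X]} {a : ℚ} (ha : h.eval a ≠ 0) :
    IsCoprime (X - C a) h := by
  rw [(irreducible_X_sub_C a).coprime_iff_not_dvd, dvd_iff_isRoot]
  exact ha

theorem isCoprime_one_sub_C_mul_X {f : ℚ[X]} {a : ℚ} (ha : a ≠ 0) (hf : f.eval a ≠ 0) :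
    IsCoprime f (1 - C (1 / a) * X) := by
  have h := (isCoprime_X_sub_C_of_eval_ne_zero hf).symm
  have : 1 - C (1 / a) * X = C (-(1 / a)) * (X - C a) := by
    rw [mul_sub, ← C_mul, C_neg, neg_mul, neg_mul, one_div_mul_cancel ha, C_neg, C_1]
    ring
  rw [this]
  exact (isCoprime_mul_unit_left_right (isUnit_C.mpr (by simp [ha])) _ _).mpr h

theorem aeval_one_sub_C_mul_X_pow_ne_zero {a : ℚ} (ha : |a| ≤ 1) {k : ℕ} (hk : k ≠ 0) {t : ℂ}
    (ht : ‖t‖ < 1) : aeval t (1 - C a * X ^ k) ≠ 0 := by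
  intro h
  rw [map_sub, map_one, map_mul, aeval_C, map_pow, aeval_X, sub_eq_zero] at h
  have h' := congrArg norm h
  rw [norm_one, norm_mul, norm_pow, eq_ratCast, Complex.norm_ratCast] at h'
  have h1 : ‖t‖ ^ k < 1 := pow_lt_one₀ (norm_nonneg _) ht hk
  have h2 : |(a : ℝ)| ≤ 1 := by exact_mod_cast ha
  nlinarith [norm_nonneg t, abs_nonneg (a : ℝ), pow_nonneg (norm_nonneg t) k]

/-- The second factor `h` of the denominator `(1 - t / q) h(t)` for an isotropic form. -/
def cofactor (q : ℚ) (a b : ℕ) (χ χ' : ℚ) : ℚ[X] :=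
  if Odd a ∧ Odd b then 1
  else if Even a ∧ Even b then 1 - C (χ * χ' / q ^ ((a + b) / 2)) * X
  else 1 - C (1 / q ^ (a + b)) * X ^ 2

theorem cofactor_comm (q : ℚ) (a b : ℕ) (χ χ' : ℚ) :
    cofactor q a b χ χ' = cofactor q b a χ' χ := by
  simp only [cofactor, and_comm, add_comm, mul_comm]

theorem coeff_zero_cofactor (q : ℚ) (a b : ℕ) (χ χ' : ℚ) : (cofactor q a b χ χ').coeff 0 = 1 := by
  unfold cofactor
  split_ifs <;> simp

theorem abs_mul_le_one_of_sign {χ χ' x : ℚ} (hχ : χ = 1 ∨ χ = -1) (hχ' : χ' = 1 ∨ χ' = -1)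
    (hx0 : 0 ≤ x) (hx1 : x ≤ 1) : |χ * χ' * x| ≤ 1 := by
  rw [abs_mul, abs_mul, abs_of_nonneg hx0]
  rcases hχ with rfl | rfl <;> rcases hχ' with rfl | rfl <;> simpa using hx1

theorem mul_one_div_pow_le_one {q : ℚ} (hq : 1 < q) {m n : ℕ} (hmn : n ≤ m) :
    1 / q ^ m * q ^ n ≤ 1 := by
  rw [one_div_mul_eq_div, div_le_one (by positivity)]
  exact pow_le_pow_right₀ hq.le hmn

/-- Strict positivity fails: for a hyperbolic plane the cofactor is itself `1 - t/q`, and the pole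
is double. -/
theorem eval_cofactor_nonneg {q : ℚ} (hq : 1 < q) {a b : ℕ} (hab : 2 ≤ a + b) {χ χ' : ℚ}
    (hχ : χ = 1 ∨ χ = -1) (hχ' : χ' = 1 ∨ χ' = -1) : 0 ≤ (cofactor q a b χ χ').eval q := by
  unfold cofactor
  split_ifs
  · simp
  · have h1 : 1 / q ^ ((a + b) / 2) * q ^ 1 ≤ 1 := mul_one_div_pow_le_one hq (by omega)
    have h2 := abs_mul_le_one_of_sign hχ hχ' (by positivity) h1
    have h3 := (abs_le.mp h2).2
    simp only [eval_sub, eval_one, eval_mul, eval_C, eval_X]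
    have : χ * χ' / q ^ ((a + b) / 2) * q = χ * χ' * (1 / q ^ ((a + b) / 2) * q ^ 1) := by ring
    linarith
  · have h1 : 1 / q ^ (a + b) * q ^ 2 ≤ 1 := mul_one_div_pow_le_one hq hab
    simp only [eval_sub, eval_one, eval_mul, eval_C, eval_X, eval_pow]
    linarith

/-- Reduction to lowest terms of the zeta function of a form `Q₀ ⊕ ϖ Q₁` with `Q₀`, `Q₁`
unimodular and not both anisotropic. -/
theorem exists_fraction_of_isotropic {Z : ℂ → ℂ} {q : ℚ} (hq : 1 < q) {a b : ℕ} (hab : 2 ≤ a + b)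
    {χ χ' : ℚ} (hχ : χ = 1 ∨ χ = -1) (hχ' : χ' = 1 ∨ χ' = -1) {A : ℚ[X]}
    (hA : A = C (1 - 1 / q) * (1 - C (1 / q ^ (a + b)) * X ^ 2 +
      (X - 1) * (C (signRatio χ q a) + C (signRatio χ' q b * (1 / q ^ a)) * X)))
    (hAq : 0 < A.eval q)
    (hZ : EqFractionOnDisc Z A ((1 - C (1 / q) * X) * (1 - C (1 / q ^ (a + b)) * X ^ 2))) :
    ∃ f, EqFractionOnDisc Z f ((1 - C (1 / q) * X) * cofactor q a b χ χ') ∧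
      IsCoprime f (cofactor q a b χ χ') ∧ 0 < f.eval q := by
  have hq0 : q ≠ 0 := by positivity
  have hu : IsUnit (C (1 - 1 / q)) := by
    refine isUnit_C.mpr (IsUnit.mk0 _ ?_)
    rw [sub_ne_zero, ne_comm, ne_eq, div_eq_one_iff_eq hq0]
    exact hq.ne
  have hpos : 0 < 1 - 1 / q := by
    rw [sub_pos, div_lt_one (by positivity)]
    exact hq
  have hlt : ∀ m, m ≠ 0 → 1 / q ^ m < 1 := fun m hm => by
    rw [div_lt_one (by positivity)]
    exact one_lt_pow₀ hq hm
  have hχ0 : χ ≠ 0 := by rcases hχ with rfl | rfl <;> norm_num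
  have hχ0' : χ' ≠ 0 := by rcases hχ' with rfl | rfl <;> norm_num
  have hX1 : ∀ {h : ℚ[X]}, h.eval 1 ≠ 0 → IsCoprime (X - 1) h := fun h1 => by
    have := isCoprime_X_sub_C_of_eval_ne_zero h1
    rwa [C_1] at this
  have hh0 := coeff_zero_cofactor q a b χ χ'
  unfold cofactor at hh0 ⊢
  split_ifs at hh0 ⊢ with h1 h2
  -- Both ranks odd: both sign ratios vanish, and the whole quadratic factor cancels.
  · refine ⟨C (1 - 1 / q), ?_, isCoprime_one_right, by simpa using hpos⟩
    refine EqFractionOnDisc.cancel (w := 1 - C (1 / q ^ (a + b)) * X ^ 2) ?_ fun t ht =>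
      aeval_one_sub_C_mul_X_pow_ne_zero ?_ two_ne_zero ht
    · rw [mul_one]
      convert hZ using 1
      rw [hA, signRatio, signRatio, if_neg (Nat.not_even_iff_odd.mpr h1.1),
        if_neg (Nat.not_even_iff_odd.mpr h1.2)]
      simp
    · rw [abs_of_pos (by positivity)]
      exact (hlt _ (by omega)).le
  · obtain ⟨⟨m, rfl⟩, ⟨n, rfl⟩⟩ := h2
    have hm : (m + m) / 2 = m := by omega
    have hn : (n + n) / 2 = n := by omega
    have hmn : (m + m + (n + n)) / 2 = m + n := by omega
    rw [hmn] at hh0 ⊢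
    set x : ℚ := 1 / q ^ m
    set y : ℚ := 1 / q ^ n
    have hxy : χ * χ' / q ^ (m + n) = χ * χ' * (x * y) := by
      simp only [x, y]; rw [pow_add]; field_simp
    have hxy' : x * y = 1 / q ^ (m + n) := by
      simp only [x, y]; rw [pow_add]; field_simp
    have hxyq : x * y * q ≤ 1 := by
      rw [hxy', ← pow_one q]
      simpa using mul_one_div_pow_le_one hq (by omega : 1 ≤ m + n)
    have hx0 : 0 < x := by positivity
    have hy0 : 0 < y := by positivity
    have hsq : χ * χ = 1 := by rcases hχ with rfl | rfl <;> norm_num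
    have hsq' : χ' * χ' = 1 := by rcases hχ' with rfl | rfl <;> norm_num
    have hr : signRatio χ q (m + m) = χ * x := by
      rw [signRatio, if_pos ⟨m, rfl⟩, hm]; simp only [x]; ring
    have hr' : signRatio χ' q (n + n) = χ' * y := by
      rw [signRatio, if_pos ⟨n, rfl⟩, hn]; simp only [y]; ring
    have hc : 1 / q ^ (m + m) = x * x := by simp only [x]; rw [pow_add]; field_simp
    have hcc : 1 / q ^ (m + m + (n + n)) = x * x * (y * y) := by
      simp only [x, y]; rw [pow_add, pow_add, pow_add]; field_simp
    rw [hr, hr', hc, hcc] at hA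
    rw [hcc] at hZ
    rw [hxy] at hh0 ⊢
    set h : ℚ[X] := 1 - C (χ * χ' * (x * y)) * X with hh
    -- Both ranks even: the quadratic factor is `h * w`, and `χ x + χ' x ^ 2 y X = χ x w` because `χ
    -- ^ 2 = 1`. So `w` divides the numerator, leaving `h + (X - 1) χ x` up to a constant.
    set w : ℚ[X] := 1 - C (-(χ * χ' * (x * y))) * X ^ 1 with hw
    set f : ℚ[X] := C (1 - 1 / q) * (h + (X - 1) * C (χ * x)) with hf
    have e1 : (C χ * C χ : ℚ[X]) = 1 := by rw [← C_mul, hsq, C_1]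
    have e2 : (C χ' * C χ' : ℚ[X]) = 1 := by rw [← C_mul, hsq', C_1]
    have hhw : h * w = 1 - C (x * x * (y * y)) * X ^ 2 := by
      rw [hh, hw]
      simp only [C_neg, C_mul, pow_one]
      linear_combination (-(C x ^ 2 * C y ^ 2 * X ^ 2 * C χ' ^ 2)) * e1 -
        (C x ^ 2 * C y ^ 2 * X ^ 2) * e2
    have hfw : f * w = A := by
      rw [hA, ← hhw, hf, hw]
      simp only [C_neg, C_mul, pow_one]
      linear_combination (C (1 - 1 / q) * (X - 1) * C x ^ 2 * C y * C χ' * X) * e1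
    refine ⟨f, EqFractionOnDisc.cancel (w := w) ?_ fun t ht =>
      aeval_one_sub_C_mul_X_pow_ne_zero ?_ one_ne_zero ht, ?_, ?_⟩
    · rwa [hfw, mul_assoc, hhw]
    · rw [abs_neg]
      refine abs_mul_le_one_of_sign hχ hχ' (by positivity) ?_
      nlinarith [mul_pos hx0 hy0]
    · rw [hf]
      refine (isCoprime_mul_unit_left_left hu _ _).mpr ?_
      refine IsCoprime.self_add_left (IsCoprime.mul_left (hX1 ?_) ?_)
      · rw [hh]
        simp only [eval_sub, eval_one, eval_mul, eval_C, eval_X, mul_one]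
        have : χ * χ' * (x * y) < 1 := by
          have h3 : x * y < 1 := by rw [hxy']; exact hlt _ (by omega)
          rcases hχ with rfl | rfl <;> rcases hχ' with rfl | rfl <;>
            nlinarith [mul_pos hx0 hy0]
        exact (sub_pos.mpr this).ne'
      · exact isCoprime_C (mul_ne_zero hχ0 hx0.ne') _
    · have hwq : 0 ≤ w.eval q := by
        rw [hw]
        simp only [eval_sub, eval_one, eval_mul, eval_C, eval_X, pow_one]
        have h3 := (abs_le.mp (abs_mul_le_one_of_sign hχ hχ'
          (mul_nonneg (mul_nonneg hx0.le hy0.le) (by positivity)) hxyq)).1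
        linarith
      rw [← hfw, eval_mul] at hAq
      by_contra! hneg
      exact hAq.not_ge (mul_nonpos_of_nonpos_of_nonneg hneg hwq)
  -- Opposite parities: exactly one sign ratio survives, so modulo `h` the numerator is a nonzero
  -- constant times `X - 1` or `(X - 1) X`, and nothing cancels.
  · refine ⟨A, hZ, ?_, hAq⟩
    set h : ℚ[X] := 1 - C (1 / q ^ (a + b)) * X ^ 2 with hh
    have hh1 : h.eval 1 ≠ 0 := by
      rw [hh]
      simp only [eval_sub, eval_one, eval_mul, eval_C, eval_X, eval_pow, one_pow, mul_one]
      exact (sub_pos.mpr (hlt _ (by omega))).ne'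
    rw [hA]
    refine (isCoprime_mul_unit_left_left hu _ _).mpr ?_
    refine IsCoprime.self_add_left (IsCoprime.mul_left (hX1 hh1) ?_)
    rw [not_and_or, Nat.not_odd_iff_even, Nat.not_odd_iff_even] at h1
    by_cases ha : Even a
    · have hb : ¬ Even b := fun hb => h2 ⟨ha, hb⟩
      rw [signRatio, signRatio, if_pos ha, if_neg hb, zero_mul, C_0, zero_mul, add_zero]
      exact isCoprime_C (by positivity) h
    · have hb : Even b := h1.resolve_left ha
      rw [signRatio, signRatio, if_neg ha, if_pos hb, C_0, zero_add]
      exact (isCoprime_C (by positivity) h).mul_left (isCoprime_X_of_coeff_zero hh0)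

/-- The denominator for a form both of whose unimodular parts are anisotropic. -/
def anisotropicDenom (q : ℚ) (a b : ℕ) : ℚ[X] :=
  if a = b then 1 - C (1 / q ^ a) * X else 1 - C (1 / q ^ (a + b)) * X ^ 2

theorem anisotropicDenom_comm (q : ℚ) (a b : ℕ) :
    anisotropicDenom q a b = anisotropicDenom q b a := by
  unfold anisotropicDenom
  by_cases h : a = b
  · rw [h]
  · rw [if_neg h, if_neg (Ne.symm h), add_comm]

theorem coeff_zero_anisotropicDenom (q : ℚ) (a b : ℕ) : (anisotropicDenom q a b).coeff 0 = 1 := by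
  unfold anisotropicDenom
  split_ifs <;> simp

/-- Reduction to lowest terms of the zeta function of a form `Q₀ ⊕ ϖ Q₁` with `Q₀`, `Q₁`
unimodular and anisotropic. -/
theorem exists_fraction_of_anisotropic {Z : ℂ → ℂ} {q : ℚ} (hq : 1 < q) {a b : ℕ} (hab : 0 < a + b)
    (hZ : EqFractionOnDisc Z (C (1 - 1 / q ^ a) + C (1 / q ^ a * (1 - 1 / q ^ b)) * X)
      (1 - C (1 / q ^ (a + b)) * X ^ 2)) :
    ∃ f, EqFractionOnDisc Z f (anisotropicDenom q a b) ∧ IsCoprime f (anisotropicDenom q a b) := by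
  have hlt : ∀ m, m ≠ 0 → 1 / q ^ m < 1 := fun m hm => by
    rw [div_lt_one (by positivity)]
    exact one_lt_pow₀ hq hm
  have hcc : 1 / q ^ (a + b) = 1 / q ^ a * (1 / q ^ b) := by rw [pow_add]; field_simp
  unfold anisotropicDenom
  split_ifs with h
  · subst h
    set x := 1 / q ^ a
    have hx : x < 1 := hlt a (by omega)
    have hx0 : 0 < x := by positivity
    -- For equal ranks the numerator is `(1 - x)(1 + x X)`, which shares the factor `1 + x X` with
    -- `1 - x ^ 2 X ^ 2`.
    refine ⟨C (1 - x), EqFractionOnDisc.cancel (w := 1 - C (-x) * X ^ 1) ?_ fun t ht =>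
      aeval_one_sub_C_mul_X_pow_ne_zero ?_ one_ne_zero ht, ?_⟩
    · rw [hcc] at hZ
      convert hZ using 1
      · simp only [C_neg, C_mul, C_sub, C_1]; ring
      · simp only [C_neg, C_mul]; ring
    · rw [abs_neg, abs_of_pos hx0]
      exact hx.le
    · exact isCoprime_C (by linarith) _
  · refine ⟨_, hZ, ?_⟩
    rw [hcc]
    set x := 1 / q ^ a
    set y := 1 / q ^ b
    have hx0 : 0 < x := by positivity
    have hxy : x - y ≠ 0 := by
      intro h'
      apply h
      have : q ^ a = q ^ b := by simpa [x, y] using sub_eq_zero.mp h'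
      exact pow_right_injective₀ (by positivity) hq.ne' this
    have hxy1 : 1 - x * y ≠ 0 := by
      have := hlt (a + b) hab.ne'
      rw [hcc] at this
      linarith
    -- This constant plays the role of a resultant of numerator and denominator; it is nonzero
    -- because the ranks differ and are not both zero.
    have hres : x * (x - y) * (1 - x * y) ≠ 0 := mul_ne_zero (mul_ne_zero hx0.ne' hxy) hxy1
    have hbez : (C (x * y) * (C (x * (1 - y)) * X - C (1 - x))) *
        (C (1 - x) + C (x * (1 - y)) * X) + C (x * (1 - y)) ^ 2 * (1 - C (x * y) * X ^ 2) =
        C (x * (x - y) * (1 - x * y)) := by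
      simp only [C_mul, C_sub, C_1]
      ring
    refine ⟨C (x * (x - y) * (1 - x * y))⁻¹ * (C (x * y) * (C (x * (1 - y)) * X - C (1 - x))),
      C (x * (x - y) * (1 - x * y))⁻¹ * C (x * (1 - y)) ^ 2, ?_⟩
    have hinv : C (x * (x - y) * (1 - x * y))⁻¹ * C (x * (x - y) * (1 - x * y)) = 1 := by
      rw [← C_mul, inv_mul_cancel₀ hres, C_1]
    linear_combination C (x * (x - y) * (1 - x * y))⁻¹ * hbez + hinv

end Fractions

end

noncomputable section

/-! ### The zeta function of a diagonal form -/

section DiagonalZeta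

/-- A shift lowers any bound `B ≥ 2` on the exponents by 1, so finitely many shifts lead to
exponents at most 1. -/
theorem shiftExp_induction {ι : Type*} [Fintype ι] {P : (ι → ℕ) → Prop}
    (base : ∀ e, (∀ j, e j ≤ 1) → P e) (step : ∀ e, P (shiftExp e) → P e) (e : ι → ℕ) : P e := by
  have key : ∀ (B : ℕ) (e : ι → ℕ), (∀ j, e j ≤ B + 1) → P e := by
    intro B
    induction B with
    | zero => exact fun e he => base e he
    | succ B ih =>
      refine fun e he => step e (ih _ fun j => ?_)
      have := he j
      unfold shiftExp
      split_ifs <;> omega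
  refine key (∑ j, e j) e fun j => ?_
  exact (Finset.single_le_sum (f := e) (fun _ _ => Nat.zero_le _) (Finset.mem_univ j)).trans
    (Nat.le_succ _)

theorem even_shiftExp {ι : Type*} (e : ι → ℕ) :
    (fun j => Even (shiftExp e j)) = fun j => Odd (e j) := by
  ext j
  unfold shiftExp
  split_ifs with h
  · simp [h]
  · rw [Nat.even_sub (by omega)]
    simp

theorem odd_shiftExp {ι : Type*} (e : ι → ℕ) :
    (fun j => Odd (shiftExp e j)) = fun j => Even (e j) := by
  ext j
  have := congrFun (even_shiftExp e) j
  rw [← Nat.not_even_iff_odd, iff_of_eq this, Nat.not_odd_iff_even]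

theorem exponents_of_le_one {ι : Type*} {e : ι → ℕ} (he : ∀ j, e j ≤ 1) :
    shiftExp (shiftExp e) = e ∧ (fun j => e j = 0) = (fun j => Even (e j)) ∧
      (fun j => shiftExp e j = 0) = fun j => Odd (e j) := by
  refine ⟨funext fun j => ?_, funext fun j => ?_, funext fun j => ?_⟩ <;>
    have := he j <;> interval_cases h : e j <;> simp [shiftExp, h]

/-- The number of variables `x_j` with `p j`. -/
def formRank {ι : Type*} (p : ι → Prop) : ℕ := Nat.card {j // p j}

variable {R : Type*} [CommRing R] [IsDomain R] [IsDiscreteValuationRing R]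
  {ι : Type*} [Fintype ι]

/-- Extension by zero: an isotropic vector of a subform is one of the larger form. -/
theorem isotropicCard_eq_zero_of_le [Finite (IsLocalRing.ResidueField R)] {u : ι → R}
    {p p' : ι → Prop} (hp : ∀ j, p j → p' j) (h : isotropicCard u p' = 0) :
    isotropicCard u p = 0 := by
  classical
  unfold isotropicCard at h ⊢
  rw [Finite.card_eq_zero_iff] at h ⊢
  refine ⟨fun ⟨b, hb0, hb⟩ => h.false
    ⟨fun j => if hj : p j then b ⟨j, hj⟩ else 0, ?_, ?_⟩⟩
  · obtain ⟨j, hj⟩ := Function.ne_iff.mp hb0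
    refine Function.ne_iff.mpr ⟨⟨j, hp _ j.2⟩, ?_⟩
    simpa [j.2] using hj
  · refine Eq.trans ?_ hb
    refine (Fintype.sum_of_injective (Subtype.map id hp)
      (Subtype.map_injective hp Function.injective_id) _ _ (fun j hj => ?_) fun j => ?_).symm
    · have : ¬ p j := fun hpj => hj ⟨⟨j, hpj⟩, rfl⟩
      simp [this]
    · simp [Subtype.map, j.2]

theorem ringChar_residueField_ne_two (h2 : IsUnit (2 : R)) :
    ringChar (IsLocalRing.ResidueField R) ≠ 2 := by
  intro h
  have h0 := ringChar.Nat.cast_ringChar (R := IsLocalRing.ResidueField R)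
  rw [h, Nat.cast_ofNat] at h0
  have := (h2.map (IsLocalRing.residue R)).ne_zero
  rw [map_ofNat] at this
  exact this h0

variable [Fintype (IsLocalRing.ResidueField R)] [DecidableEq (IsLocalRing.ResidueField R)]

open Classical in
/-- The value of the quadratic character at the signed discriminant of the reduction of the form
`∑ u_j x_j ^ 2`, where the sum is over all `j` with `p j`. -/
def formSign (u : ι → R) (p : ι → Prop) : ℤ :=
  quadraticChar (IsLocalRing.ResidueField R)
    ((-1) ^ (formRank p / 2) * ∏ j : {j // p j}, IsLocalRing.residue R (u j))

theorem formSign_eq_one_or (u : ι → R) (hu : ∀ j, IsUnit (u j)) (p : ι → Prop) :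
    (formSign u p : ℚ) = 1 ∨ (formSign u p : ℚ) = -1 := by
  classical
  have : (-1) ^ (formRank p / 2) * ∏ j : {j // p j}, IsLocalRing.residue R (u j) ≠ 0 :=
    mul_ne_zero (by simp) (Finset.prod_ne_zero_iff.mpr fun j _ => ((hu j).map _).ne_zero)
  rcases quadraticChar_dichotomy this with h | h
  · left; rw [formSign, h, Int.cast_one]
  · right; rw [formSign, h, Int.cast_neg, Int.cast_one]

theorem isotropicCard_eq (h2 : IsUnit (2 : R)) {u : ι → R} (hu : ∀ j, IsUnit (u j))
    (p : ι → Prop) :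
    (residueCard R : ℚ) * (isotropicCard u p + 1) = (residueCard R : ℚ) ^ formRank p *
      (1 + (residueCard R - 1) * signRatio (formSign u p) (residueCard R) (formRank p)) := by
  classical
  have h := card_diagonal_zeros (ringChar_residueField_ne_two h2)
    (fun j : {j // p j} => IsLocalRing.residue R (u j)) fun j => ((hu j).map _).ne_zero
  have hq : residueCard R = Fintype.card (IsLocalRing.ResidueField R) := Nat.card_eq_fintype_card
  have hr : formRank p = Fintype.card {j // p j} := Nat.card_eq_fintype_card
  rw [formSign, hr, hq, ← h]
  congr 1
  rw [isotropicCard, Nat.card_eq_fintype_card, Nat.card_eq_fintype_card, Fintype.card_subtype,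
    Fintype.card_subtype]
  have : (Finset.univ.filter fun y : {j // p j} → IsLocalRing.ResidueField R =>
      ∑ j : {j // p j}, IsLocalRing.residue R (u j) * y j ^ 2 = 0) =
      insert 0 (Finset.univ.filter fun y : {j // p j} → IsLocalRing.ResidueField R =>
      y ≠ 0 ∧ ∑ j : {j // p j}, IsLocalRing.residue R (u j) * y j ^ 2 = 0) := by
    ext y
    by_cases hy : y = 0 <;> simp [hy]
  rw [this, Finset.card_insert_of_notMem (by simp)]
  push_cast
  rfl

/-- The numerator of the contribution of the smooth points to the zeta function. -/
def smoothNumerator (q c l : ℚ) : ℚ[X] :=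
  C (1 - 1 / q) * (1 - C c * X + (X - 1) * C l)

theorem smoothNumerator_eq {q c l x : ℚ} (hx : x = 1 / q + (1 - 1 / q) * l - c) :
    smoothNumerator q c l =
      C (1 - c - x) * (1 - C (1 / q) * X) + C (x * (1 - 1 / q)) * X := by
  rw [hx, smoothNumerator]
  generalize 1 / q = y
  simp only [C_sub, C_mul, C_add, C_1]
  ring

/-- With `x = c N` this is nonnegative, and positive as soon as an isotropic vector exists; it is
what keeps the pole at `t = q` from cancelling. -/
theorem eval_smoothNumerator {q c l x : ℚ} (hq : q ≠ 0) (hx : x = 1 / q + (1 - 1 / q) * l - c) :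
    (smoothNumerator q c l).eval q = (q - 1) * x := by
  rw [smoothNumerator_eq hx]
  simp only [eval_add, eval_mul, eval_C, eval_sub, eval_one, eval_X]
  field_simp
  ring

/-- The number of isotropic vectors in terms of the signed discriminant. -/
theorem div_mul_isotropicCard (h2 : IsUnit (2 : R)) {u : ι → R} (hu : ∀ j, IsUnit (u j))
    (p : ι → Prop) {c q : ℚ} (hq : q = residueCard R) (hc : c = 1 / q ^ formRank p) :
    c * isotropicCard u p =
      1 / q + (1 - 1 / q) * signRatio (formSign u p) q (formRank p) - c := by
  have hq0 : q ≠ 0 := by rw [hq]; exact_mod_cast (residueCard_pos (R := R)).ne'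
  have h := isotropicCard_eq h2 hu p
  rw [← hq] at h
  have hcq : c * q ^ formRank p = 1 := by rw [hc]; field_simp
  have h' : q * (c * isotropicCard u p + c) =
      1 + (q - 1) * signRatio (formSign u p) q (formRank p) := by
    linear_combination c * h + (1 + (q - 1) * signRatio (formSign u p) q (formRank p)) * hcq
  field_simp
  linear_combination h'

end DiagonalZeta

/-! ### The functional recursion for the zeta function and its solution -/

section DiagonalZetaFunction

variable {R : Type*} [CommRing R] {ι : Type*} [Fintype ι] [TopologicalSpace R] [IsTopologicalRing R] [CompactSpace R]
  [MeasurableSpace R] [BorelSpace R]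

/-- The measure of the set of points at which a diagonal form is divisible by `ϖ ^ k`. -/
def diagDensity (ϖ : R) (u : ι → R) (e : ι → ℕ) (k : ℕ) : ℝ :=
  (haarProb R ι).real {x | ϖ ^ k ∣ diagForm ϖ u e x}

theorem diagDensity_zero (ϖ : R) (u : ι → R) (e : ι → ℕ) : diagDensity ϖ u e 0 = 1 := by
  simp [diagDensity]

/-- The zeta function of a diagonal form, as a function of `t = q ^ (-s)`. -/
def diagZeta (ϖ : R) (u : ι → R) (e : ι → ℕ) : ℂ → ℂ := differenceSeries (diagDensity ϖ u e)

variable [IsDomain R] [IsDiscreteValuationRing R] [T2Space R] [SecondCountableTopology R]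
  [Finite (IsLocalRing.ResidueField R)]

theorem diagDensity_succ {ϖ : R} (hϖ : Irreducible ϖ) (h2 : IsUnit (2 : R))
    {u : ι → R} (hu : ∀ j, IsUnit (u j)) (e : ι → ℕ) (k : ℕ) :
    diagDensity ϖ u e (k + 1) = (1 / (residueCard R : ℝ) ^ formRank (fun j => e j = 0)) *
      (isotropicCard u (fun j => e j = 0) * (residueCard R : ℝ)⁻¹ ^ k +
        diagDensity ϖ u (shiftExp e) k) := by
  have hq : (residueCard R : ENNReal)⁻¹ ≠ ⊤ := by
    rw [ENNReal.inv_ne_top]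
    exact_mod_cast (residueCard_pos (R := R)).ne'
  simp only [diagDensity, Measure.real]
  rw [haarProb_dvd_diagForm_succ hϖ h2 hu, ENNReal.toReal_mul, ENNReal.toReal_add
    (ENNReal.mul_ne_top (ENNReal.natCast_ne_top _) (ENNReal.pow_ne_top hq)) (measure_ne_top _ _),
    ENNReal.toReal_mul, ENNReal.toReal_pow, ENNReal.toReal_pow, ENNReal.toReal_inv,
    ENNReal.toReal_natCast, ENNReal.toReal_natCast, formRank, Nat.card_eq_fintype_card, inv_pow,
    one_div]

theorem diagZeta_eq {ϖ : R} (hϖ : Irreducible ϖ) (h2 : IsUnit (2 : R))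
    {u : ι → R} (hu : ∀ j, IsUnit (u j)) (e : ι → ℕ) {c N q : ℚ}
    (hq : q = residueCard R) (hc : c = 1 / q ^ formRank fun j => e j = 0)
    (hN : N = isotropicCard u fun j => e j = 0) {t : ℂ} (ht : ‖t‖ < 1) :
    diagZeta ϖ u e t = (1 - c - c * N) + c * N * (1 - (q : ℂ)⁻¹) * t / (1 - t / q) +
      c * t * diagZeta ϖ u (shiftExp e) t := by
  have h := differenceSeries_eq (a := diagDensity ϖ u e) (b := diagDensity ϖ u (shiftExp e))
    (q := (q : ℝ)) (c := (c : ℝ)) (N := (N : ℝ))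
    (fun k => measureReal_nonneg) (fun k => measureReal_le_one)
    (diagDensity_zero _ _ _) (diagDensity_zero _ _ _)
    (by rw [hq]; exact_mod_cast one_lt_residueCard (R := R)) (fun k => ?_) ht
  · simp only [Complex.ofReal_ratCast] at h
    exact h
  · rw [diagDensity_succ hϖ h2 hu, hN, hc, hq]
    push_cast
    rfl

/-- For anisotropic reduction the smooth points contribute a constant. -/
theorem diagZeta_eq_of_anisotropic {ϖ : R} (hϖ : Irreducible ϖ) (h2 : IsUnit (2 : R))
    {u : ι → R} (hu : ∀ j, IsUnit (u j)) (e : ι → ℕ) {c q : ℚ}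
    (hq : q = residueCard R) (hc : c = 1 / q ^ formRank fun j => e j = 0)
    (hN : isotropicCard u (fun j => e j = 0) = 0) {t : ℂ} (ht : ‖t‖ < 1) :
    diagZeta ϖ u e t = aeval t (C (1 - c)) + aeval t (C c * X) * diagZeta ϖ u (shiftExp e) t := by
  rw [diagZeta_eq hϖ h2 hu e hq hc rfl ht, hN]
  simp

/-- The zeta function of a nonzero diagonal form whose even and odd parts are anisotropic. -/
theorem exists_fraction_diagZeta_of_anisotropic {ϖ : R} (hϖ : Irreducible ϖ) (h2 : IsUnit (2 : R))
    {u : ι → R} (hu : ∀ j, IsUnit (u j)) {q : ℚ} (hq : q = residueCard R) (e : ι → ℕ) :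
    0 < formRank (fun j => Even (e j)) + formRank (fun j => Odd (e j)) →
    isotropicCard u (fun j => Even (e j)) = 0 → isotropicCard u (fun j => Odd (e j)) = 0 →
    ∃ f g, g = anisotropicDenom q (formRank fun j => Even (e j)) (formRank fun j => Odd (e j)) ∧
      EqFractionOnDisc (diagZeta ϖ u e) f g ∧ IsCoprime f g := by
  have hq1 : 1 < q := by rw [hq]; exact_mod_cast one_lt_residueCard (R := R)
  have hq0 : 0 < q := by positivity
  induction e using shiftExp_induction with
  | base e he =>
    intro hr hN hN'
    obtain ⟨hee, h0, h1⟩ := exponents_of_le_one he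
    have hZ0 := fun (hN) {t : ℂ} (ht : ‖t‖ < 1) =>
      diagZeta_eq_of_anisotropic hϖ h2 hu e hq rfl hN ht
    have hZ1 := fun (hN) {t : ℂ} (ht : ‖t‖ < 1) =>
      diagZeta_eq_of_anisotropic hϖ h2 hu (shiftExp e) hq rfl hN ht
    rw [hee] at hZ1
    rw [h0] at hZ0
    rw [h1] at hZ1
    set a := formRank fun j => Even (e j)
    set b := formRank fun j => Odd (e j)
    refine Exists.elim (exists_fraction_of_anisotropic (Z := diagZeta ϖ u e) hq1 hr ?_)
      fun f hf => ⟨f, _, rfl, hf⟩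
    · intro t ht
      -- With exponents at most 1 two shifts are the identity, so these two relations form a linear
      -- system for the form and its shift; substituting the second into the first gives the
      -- fraction.
      have e0 := hZ0 hN ht
      have e1 := hZ1 hN' ht
      have : 1 / q ^ (a + b) = 1 / q ^ a * (1 / q ^ b) := by rw [pow_add]; field_simp
      rw [this]
      simp only [map_mul, map_add, map_sub, map_one, map_pow, aeval_X] at e0 e1 ⊢
      linear_combination e0 + aeval t (C (1 / q ^ a)) * t * e1
  | step e ih =>
    intro hr hN hN'
    rw [even_shiftExp, odd_shiftExp] at ih
    obtain ⟨f, g, hg, hZ, hco⟩ := ih (by omega) hN' hN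
    set c := 1 / q ^ formRank fun j => e j = 0 with hc
    have hc0 : 0 < c := by positivity
    have hg0 : g.coeff 0 = 1 := by rw [hg]; exact coeff_zero_anisotropicDenom _ _ _
    have hNe : isotropicCard u (fun j => e j = 0) = 0 :=
      isotropicCard_eq_zero_of_le (fun j hj => by rw [hj]; exact Even.zero) hN
    refine ⟨C (1 - c) * g + C c * X * f, g, by rw [hg, anisotropicDenom_comm], fun t ht => ?_, ?_⟩
    · have e0 := diagZeta_eq_of_anisotropic hϖ h2 hu e hq hc hNe ht
      have e1 := hZ t ht
      simp only [map_mul, map_add] at e0 e1 ⊢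
      linear_combination (aeval t g) * e0 + aeval t (C c) * aeval t (X : ℚ[X]) * e1
    · have hCc := isCoprime_C hc0.ne' g
      have := ((hCc.mul_left (isCoprime_X_of_coeff_zero hg0)).mul_left hco).add_mul_right_left
        (C (1 - c))
      rwa [add_comm] at this

variable [Fintype (IsLocalRing.ResidueField R)] [DecidableEq (IsLocalRing.ResidueField R)]

theorem diagZeta_mul_eq {ϖ : R} (hϖ : Irreducible ϖ) (h2 : IsUnit (2 : R))
    {u : ι → R} (hu : ∀ j, IsUnit (u j)) (e : ι → ℕ) {c q : ℚ}
    (hq : q = residueCard R) (hc : c = 1 / q ^ formRank fun j => e j = 0) {t : ℂ} (ht : ‖t‖ < 1) :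
    diagZeta ϖ u e t * aeval t (1 - C (1 / q) * X) =
      aeval t (smoothNumerator q c
        (signRatio (formSign u fun j => e j = 0) q (formRank fun j => e j = 0))) +
      aeval t (C c * X) * (diagZeta ϖ u (shiftExp e) t * aeval t (1 - C (1 / q) * X)) := by
  have hq1 : 1 < q := by rw [hq]; exact_mod_cast one_lt_residueCard (R := R)
  have hne := aeval_one_sub_C_mul_X_pow_ne_zero (a := 1 / q) (k := 1)
    (by rw [abs_of_pos (by positivity), div_le_one (by positivity)]; exact hq1.le) one_ne_zero ht
  have hN := div_mul_isotropicCard h2 hu (fun j => e j = 0) hq hc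
  have hx : (c : ℂ) * ((isotropicCard u fun j => e j = 0 : ℕ) : ℚ) =
      ((c * isotropicCard u fun j => e j = 0 : ℚ) : ℂ) := by push_cast; rfl
  rw [diagZeta_eq hϖ h2 hu e hq hc rfl ht, hx, smoothNumerator_eq hN]
  generalize c * (isotropicCard u fun j => e j = 0 : ℚ) = x
  simp only [map_sub, map_mul, map_one, map_add, aeval_C, aeval_X, eq_ratCast, pow_one,
    Rat.cast_div, Rat.cast_one] at hne ⊢
  have hne' : (1 - t / q : ℂ) ≠ 0 := by
    convert hne using 1
    ring
  have hdiv : t / (1 - t / q : ℂ) * (1 - 1 / q * t) = t := by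
    rw [show (1 - 1 / q * t : ℂ) = 1 - t / q by ring]
    exact div_mul_cancel₀ _ hne'
  linear_combination (x : ℂ) * (1 - 1 / q) * hdiv

/-- The zeta function of a diagonal form of rank at least `2` whose even and odd parts are not both
anisotropic. -/
theorem exists_fraction_diagZeta_of_isotropic {ϖ : R} (hϖ : Irreducible ϖ) (h2 : IsUnit (2 : R))
    {u : ι → R} (hu : ∀ j, IsUnit (u j)) {q : ℚ} (hq : q = residueCard R) (e : ι → ℕ) :
    2 ≤ formRank (fun j => Even (e j)) + formRank (fun j => Odd (e j)) →
    0 < isotropicCard u (fun j => Even (e j)) + isotropicCard u (fun j => Odd (e j)) →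
    ∃ f h, h = cofactor q (formRank fun j => Even (e j)) (formRank fun j => Odd (e j))
        (formSign u fun j => Even (e j)) (formSign u fun j => Odd (e j)) ∧
      EqFractionOnDisc (diagZeta ϖ u e) f ((1 - C (1 / q) * X) * h) ∧
      IsCoprime f h ∧ 0 < f.eval q := by
  have hq1 : 1 < q := by rw [hq]; exact_mod_cast one_lt_residueCard (R := R)
  have hq0 : 0 < q := by positivity
  have hJ : ∀ (e : ι → ℕ) {c : ℚ} (_ : c = 1 / q ^ formRank fun j => e j = 0),
      (smoothNumerator q c
        (signRatio (formSign u fun j => e j = 0) q (formRank fun j => e j = 0))).eval q =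
      (q - 1) * (c * isotropicCard u (fun j => e j = 0)) := fun e c hc =>
    eval_smoothNumerator hq0.ne' (div_mul_isotropicCard h2 hu _ hq hc)
  induction e using shiftExp_induction with
  | base e he =>
    intro hr hN
    obtain ⟨hee, h0, h1⟩ := exponents_of_le_one he
    have hJ0 := hJ e rfl
    have hJ1 := hJ (shiftExp e) rfl
    have hZ0 := fun {t : ℂ} (ht : ‖t‖ < 1) => diagZeta_mul_eq hϖ h2 hu e hq rfl ht
    have hZ1 := fun {t : ℂ} (ht : ‖t‖ < 1) => diagZeta_mul_eq hϖ h2 hu (shiftExp e) hq rfl ht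
    rw [hee] at hZ1
    rw [h0] at hZ0 hJ0
    rw [h1] at hZ1 hJ1
    set a := formRank fun j => Even (e j)
    set b := formRank fun j => Odd (e j)
    set l := signRatio (formSign u fun j => Even (e j)) q a with hl
    set l' := signRatio (formSign u fun j => Odd (e j)) q b with hl'
    set A := smoothNumerator q (1 / q ^ a) l +
      C (1 / q ^ a) * X * smoothNumerator q (1 / q ^ b) l' with hA
    refine Exists.elim (exists_fraction_of_isotropic (Z := diagZeta ϖ u e) hq1 hr
      (formSign_eq_one_or u hu fun j => Even (e j)) (formSign_eq_one_or u hu fun j => Odd (e j))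
      (A := A) ?_ ?_ ?_) fun f hf => ⟨f, _, rfl, hf⟩
    · rw [hA, ← hl, ← hl', smoothNumerator, smoothNumerator]
      have : 1 / q ^ (a + b) = 1 / q ^ a * (1 / q ^ b) := by rw [pow_add]; field_simp
      rw [this]
      simp only [C_mul]
      ring
    · rw [hA, eval_add, eval_mul, hJ0, hJ1, eval_mul, eval_C, eval_X]
      have h3 : 0 < q - 1 := by linarith
      rcases Nat.eq_zero_or_pos (isotropicCard u fun j => Even (e j)) with h | h
      · have h' : 0 < isotropicCard u fun j => Odd (e j) := by omega
        rw [h]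
        positivity
      · positivity
    · intro t ht
      have e0 := hZ0 ht
      have e1 := hZ1 ht
      have : 1 / q ^ (a + b) = 1 / q ^ a * (1 / q ^ b) := by rw [pow_add]; field_simp
      rw [this]
      simp only [hA, map_mul, map_add, map_sub, map_one, map_pow, aeval_X] at e0 e1 ⊢
      linear_combination e0 + aeval t (C (1 / q ^ a)) * t * e1
  | step e ih =>
    intro hr hN
    rw [even_shiftExp, odd_shiftExp] at ih
    obtain ⟨f, h, hh, hZ, hco, hpos⟩ := ih (by omega) (by omega)
    set c := 1 / q ^ formRank fun j => e j = 0 with hc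
    have hJe := hJ e hc
    set J := smoothNumerator q c
      (signRatio (formSign u fun j => e j = 0) q (formRank fun j => e j = 0)) with hJdef
    have hc0 : 0 < c := by positivity
    have hh0 : h.coeff 0 = 1 := by rw [hh]; exact coeff_zero_cofactor _ _ _ _ _
    have hhq : 0 ≤ h.eval q := by
      rw [hh]
      exact eval_cofactor_nonneg hq1 (by omega) (formSign_eq_one_or u hu _)
        (formSign_eq_one_or u hu _)
    refine ⟨J * h + C c * X * f, h, by rw [hh, cofactor_comm], fun t ht => ?_, ?_, ?_⟩
    · have e0 := diagZeta_mul_eq hϖ h2 hu e hq hc ht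
      have e1 := hZ t ht
      simp only [map_mul, map_add] at e0 e1 ⊢
      linear_combination (aeval t h) * e0 + aeval t (C c) * aeval t (X : ℚ[X]) * e1
    -- Modulo `h` the new numerator is `c X f`, a product of factors coprime to `h`.
    · have hCc := isCoprime_C hc0.ne' h
      have := ((hCc.mul_left (isCoprime_X_of_coeff_zero hh0)).mul_left hco).add_mul_right_left J
      rwa [add_comm] at this
    · rw [eval_add, eval_mul, eval_mul, eval_mul, hJe, eval_C, eval_X]
      have h3 : 0 < q - 1 := by linarith
      positivity

end DiagonalZetaFunction
end

noncomputable section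

/-! ### Reduction of a quadratic form to diagonal form -/

section SecondCountable

/-- The map to the product of the finite discrete quotients `R ⧸ I ^ n` is injective by Krull's
intersection theorem, and an embedding because `R` is compact. -/
theorem IsDiscreteValuationRing.secondCountableTopology (R : Type*) [CommRing R] [IsDomain R]
    [IsDiscreteValuationRing R] [TopologicalSpace R] [IsTopologicalRing R] [CompactSpace R]
    [T2Space R] : SecondCountableTopology R := by
  set I := IsLocalRing.maximalIdeal R
  have hopen : ∀ n, IsOpen ((I ^ n : Ideal R) : Set R) := IsLocalRing.isOpen_maximalIdeal_pow R
  let τ : ∀ n, TopologicalSpace (R ⧸ I ^ n) := fun _ => ⊥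
  have hd : ∀ n, DiscreteTopology (R ⧸ I ^ n) := fun _ => ⟨rfl⟩
  have hfin : ∀ n, Finite (R ⧸ I ^ n) := fun n =>
    IsLocalRing.isOpen_iff_finite_quotient.mp (hopen n)
  have hcont : Continuous fun (x : R) (n : ℕ) => Ideal.Quotient.mk (I ^ n) x := by
    refine continuous_pi fun n => continuous_discrete_rng.mpr fun c => ?_
    obtain ⟨a, rfl⟩ := Ideal.Quotient.mk_surjective c
    have : (fun x => Ideal.Quotient.mk (I ^ n) x) ⁻¹' {Ideal.Quotient.mk (I ^ n) a} =
        (fun x => x - a) ⁻¹' ((I ^ n : Ideal R) : Set R) := by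
      ext x
      simp [Ideal.Quotient.eq]
    rw [this]
    exact (hopen n).preimage (by fun_prop)
  have hinj : Function.Injective fun (x : R) (n : ℕ) => Ideal.Quotient.mk (I ^ n) x := by
    intro x y hxy
    have h : ∀ n, x - y ∈ I ^ n := fun n => Ideal.Quotient.eq.mp (congrFun hxy n)
    have h0 : x - y ∈ ⨅ n, I ^ n := Ideal.mem_iInf.mpr h
    rw [Ideal.iInf_pow_eq_bot_of_isLocalRing I (IsLocalRing.maximalIdeal.isMaximal R).ne_top,
      Ideal.mem_bot, sub_eq_zero] at h0
    exact h0
  exact (hcont.isClosedEmbedding hinj).isEmbedding.secondCountableTopology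

end SecondCountable

/-! ### Pullback of a diagonal form -/

section Transfer

theorem squareClass_prod {R : Type*} [CommRing R] {κ : Type*} (s : Finset κ) (u : κ → Rˣ) :
    squareClass (∏ j ∈ s, u j) = ∏ j ∈ s, squareClass (u j) := by
  classical
  induction s using Finset.induction_on with
  | empty => rfl
  | insert a s ha ih =>
    rw [Finset.prod_insert ha, Finset.prod_insert ha, ← ih]
    rfl

theorem toQuadraticForm'_apply {R : Type*} [CommRing R] {ι : Type*} [Fintype ι] [DecidableEq ι]
    (A : Matrix ι ι R) (x : ι → R) : A.toQuadraticForm' x = x ⬝ᵥ A.mulVec x := by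
  rw [Matrix.toQuadraticForm', LinearMap.BilinMap.toQuadraticMap_apply,
    Matrix.toLinearMap₂'_apply']

theorem toQuadraticForm'_mulVec_of_congruent {R : Type*} [CommRing R] {ι : Type*} [Fintype ι]
    [DecidableEq ι] {A P : Matrix ι ι R} {w : ι → R}
    (h : P.transpose * A * P = Matrix.diagonal w) (y : ι → R) :
    A.toQuadraticForm' (P.mulVec y) = ∑ j, w j * y j ^ 2 := by
  have : A.toQuadraticForm' (P.mulVec y) = y ⬝ᵥ (P.transpose * A * P).mulVec y := by
    rw [toQuadraticForm'_apply, ← Matrix.mulVec_mulVec, ← Matrix.mulVec_mulVec,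
      Matrix.dotProduct_mulVec y, Matrix.vecMul_transpose]
  rw [this, h, dotProduct]
  refine Finset.sum_congr rfl fun j _ => ?_
  rw [Matrix.mulVec_diagonal]
  ring

variable {R : Type*} [CommRing R] [IsDomain R] [IsDiscreteValuationRing R]

/-- Diagonalization of all unimodular components: there are units `u`, with the same discriminants
as the given forms, and a surjective linear map pulling back the diagonal form with
coefficients `ϖ ^ i u_{ij}` to the given form. -/
theorem exists_diagForm_pullback (h2 : IsUnit (2 : R)) (ϖ : R) {n : ℕ}
    (A : Matrix (Fin n) (Fin n) R) {N : ℕ} {ρ : Fin N → ℕ}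
    (M : ∀ i, Matrix (Fin (ρ i)) (Fin (ρ i)) R) (hM : ∀ i, (M i).IsSymm)
    (hdet : ∀ i, IsUnit (M i).det) {m : ℕ}
    (hequiv : A.toQuadraticForm'.Equivalent (diagonalSum ϖ M m)) :
    ∃ (u : (Σ i, Fin (ρ i)) → Rˣ) (f : (Fin n → R) →ₗ[R] ((Σ i, Fin (ρ i)) → R)),
      (∀ i, unimodularDisc (M i) (hdet i) = ∏ j, squareClass (u ⟨i, j⟩)) ∧
      Function.Surjective f ∧
      ∀ x, MvPolynomial.eval x (quadPoly A) =
        diagForm ϖ (fun j => (u j : R)) (fun j => (j.1 : ℕ)) (f x) := by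
  obtain ⟨φ⟩ := hequiv
  have hdiag : ∀ i, ∃ w, MatrixCongruent (M i) (Matrix.diagonal w) := fun i =>
    MatrixCongruent.exists_diagonal h2 _ rfl (hM i) (hdet i)
  choose w P hP hPw using hdiag
  have hdetw : ∀ i, (P i).det * (M i).det * (P i).det = ∏ j, w i j := fun i => by
    have := congrArg Matrix.det (hPw i)
    rwa [Matrix.det_mul, Matrix.det_mul, Matrix.det_transpose, Matrix.det_diagonal] at this
  have hw : ∀ i j, IsUnit (w i j) := fun i j => by
    have h : IsUnit (∏ j, w i j) := by
      rw [← hdetw i]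
      exact ((hP i).mul (hdet i)).mul (hP i)
    exact isUnit_of_dvd_unit (Finset.dvd_prod_of_mem _ (Finset.mem_univ j)) h
  set u : (Σ i, Fin (ρ i)) → Rˣ := fun j => (hw j.1 j.2).unit with hu
  let g : ((∀ i, Fin (ρ i) → R) × (Fin m → R)) →ₗ[R] ((Σ i, Fin (ρ i)) → R) :=
    LinearMap.pi fun j => LinearMap.proj j.2 ∘ₗ (P j.1)⁻¹.mulVecLin ∘ₗ LinearMap.proj j.1 ∘ₗ
      LinearMap.fst R _ _
  have hg : ∀ z i j, g z ⟨i, j⟩ = (P i)⁻¹.mulVec (z.1 i) j := fun z i j => rfl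
  refine ⟨u, g ∘ₗ φ.toLinearEquiv.toLinearMap, fun i => ?_, ?_, fun x => ?_⟩
  -- Congruence multiplies the determinant by a unit square, so the square class is unchanged.
  · have h1 : (∏ j, u ⟨i, j⟩ : Rˣ) = (hdet i).unit * (hP i).unit ^ 2 := by
      ext
      rw [Units.coe_prod]
      simp only [hu, IsUnit.unit_spec, Units.val_mul, Units.val_pow_eq_pow_val]
      rw [← hdetw i]
      ring
    have h2 : ∏ j, squareClass (u ⟨i, j⟩) = squareClass (∏ j, u ⟨i, j⟩) :=
      (squareClass_prod _ _).symm
    rw [h2, h1, unimodularDisc, squareClass, squareClass, QuotientGroup.eq]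
    exact ⟨(hP i).unit, by simp⟩
  · rw [LinearMap.coe_comp]
    refine Function.Surjective.comp (fun y => ?_) φ.toLinearEquiv.surjective
    refine ⟨(fun i => (P i).mulVec fun j => y ⟨i, j⟩, 0), funext fun ⟨i, j⟩ => ?_⟩
    rw [hg, Matrix.mulVec_mulVec, Matrix.nonsing_inv_mul _ (hP i), Matrix.one_mulVec]
  · have hz : ∀ z, diagonalSum ϖ M m z =
        diagForm ϖ (fun j => (u j : R)) (fun j => (j.1 : ℕ)) (g z) := by
      intro z
      have h0 : diagonalSum ϖ M m z = ∑ i : Fin N, ϖ ^ (i : ℕ) * (M i).toQuadraticForm' (z.1 i) := by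
        simp [diagonalSum, QuadraticMap.prod_apply, QuadraticMap.pi_apply]
      rw [h0, diagForm, Fintype.sum_sigma]
      refine Finset.sum_congr rfl fun i _ => ?_
      have h1 : z.1 i = (P i).mulVec fun j => g z ⟨i, j⟩ := by
        have : (fun j => g z ⟨i, j⟩) = (P i)⁻¹.mulVec (z.1 i) := funext fun j => hg z i j
        rw [this, Matrix.mulVec_mulVec, Matrix.mul_nonsing_inv _ (hP i), Matrix.one_mulVec]
      conv_lhs => rw [h1]
      rw [toQuadraticForm'_mulVec_of_congruent (hPw i), Finset.mul_sum]
      refine Finset.sum_congr rfl fun j _ => ?_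
      simp only [hu, IsUnit.unit_spec]
      ring
    rw [eval_quadPoly, ← φ.map_app, hz]
    rfl

end Transfer

section LinearSurjection

variable {R : Type*} [CommRing R] [TopologicalSpace R] [IsTopologicalRing R] [CompactSpace R]
  [MeasurableSpace R] [BorelSpace R]

/-- The image of a Haar measure under a continuous surjective homomorphism of compact groups is
Haar, and both total masses are 1. This handles the change of variables and the unused variables
together. -/
theorem measurePreserving_of_linear_surjective [SecondCountableTopology R]
    {ι κ : Type*} [Fintype ι] [Fintype κ]
    (f : (ι → R) →ₗ[R] (κ → R)) (hf : Function.Surjective f) :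
    MeasurePreserving f (haarProb R ι) (haarProb R κ) :=
  AddMonoidHom.measurePreserving (f := f.toAddMonoidHom) (LinearMap.continuous_on_pi f) hf
    (by rw [measure_univ, measure_univ])

end LinearSurjection

end

noncomputable section

/-! ### Square classes of units in a Henselian local ring -/

section SquareClasses

theorem squareClass_mul {R : Type*} [CommRing R] (a b : Rˣ) :
    squareClass (a * b) = squareClass a * squareClass b := rfl

theorem squareClass_pow {R : Type*} [CommRing R] (a : Rˣ) (n : ℕ) :
    squareClass (a ^ n) = squareClass a ^ n := rfl

theorem SquareClass.exists_rep {R : Type*} [CommRing R] (c : SquareClass R) :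
    ∃ u : Rˣ, squareClass u = c := QuotientGroup.mk_surjective c

theorem SquareClass.one_mul {R : Type*} [CommRing R] (c : SquareClass R) : 1 * c = c :=
  _root_.one_mul c

theorem SquareClass.mul_self {R : Type*} [CommRing R] (c : SquareClass R) : c * c = 1 := by
  obtain ⟨u, rfl⟩ := c.exists_rep
  rw [← squareClass_mul, squareClass_eq_one_iff]
  exact ⟨u, rfl⟩

theorem squareClassEta_eq_one_iff {R : Type*} [CommRing R] (c : SquareClass R) : squareClassEta c = 1 ↔ c = 1 := by
  unfold squareClassEta
  split_ifs with h
  · simp [h]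
  · simp only [h, iff_false]; norm_num

theorem squareClassEta_eq_neg_one_iff {R : Type*} [CommRing R] (c : SquareClass R) : squareClassEta c = -1 ↔ c ≠ 1 := by
  unfold squareClassEta
  split_ifs with h
  · simp only [h, ne_eq, not_true_eq_false, iff_false]; norm_num
  · simp [h]

theorem SquareClass.pow_mul_mul_pow_mul {R : Type*} [CommRing R] (a x y : SquareClass R)
    (m n : ℕ) : a ^ m * x * (a ^ n * y) = a ^ (m + n) * (x * y) := by
  obtain ⟨u, rfl⟩ := a.exists_rep
  obtain ⟨v, rfl⟩ := x.exists_rep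
  obtain ⟨w, rfl⟩ := y.exists_rep
  have h : u ^ m * v * (u ^ n * w) = u ^ (m + n) * (v * w) := by
    rw [mul_mul_mul_comm, pow_add]
  exact congrArg squareClass h

variable {R : Type*} [CommRing R] [IsLocalRing R] [HenselianRing R (IsLocalRing.maximalIdeal R)]

/-- Hensel's lemma for `X ^ 2 - u`, whose derivative `2 a₀` at an approximate root is a unit. It
identifies `η` with the quadratic character of the residue field. -/
theorem isSquare_unit_iff_residue (h2 : IsUnit (2 : R)) (u : Rˣ) :
    IsSquare u ↔ IsSquare (IsLocalRing.residue R u) := by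
  constructor
  · rintro ⟨v, rfl⟩
    exact ⟨IsLocalRing.residue R v, by simp⟩
  · rintro ⟨b, hb⟩
    obtain ⟨a₀, rfl⟩ := IsLocalRing.residue_surjective b
    have ha₀ : IsUnit a₀ := by
      rw [← IsLocalRing.residue_ne_zero_iff_isUnit]
      intro h
      rw [h, mul_zero] at hb
      exact (u.isUnit.map (IsLocalRing.residue R)).ne_zero hb
    obtain ⟨a, ha, -⟩ := HenselianRing.is_henselian (I := IsLocalRing.maximalIdeal R)
      (X ^ 2 - C (u : R)) (monic_X_pow_sub_C _ two_ne_zero) a₀ (by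
        rw [← IsLocalRing.residue_eq_zero_iff]
        simp only [eval_sub, eval_pow, eval_X, eval_C, map_sub, map_pow]
        rw [hb, pow_two, sub_self]) (by
        refine IsUnit.map _ ?_
        simp only [derivative_sub, derivative_X_pow, derivative_C, sub_zero, eval_mul, eval_C,
          eval_X, Nat.cast_ofNat, pow_one, Nat.add_one_sub_one]
        exact h2.mul ha₀)
    have h : a * a = u := by
      simpa [IsRoot, sub_eq_zero, pow_two] using ha
    have hau : IsUnit a := isUnit_of_mul_isUnit_left (h ▸ u.isUnit)
    exact ⟨hau.unit, Units.ext h.symm⟩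

variable [Fintype (IsLocalRing.ResidueField R)] [DecidableEq (IsLocalRing.ResidueField R)]

theorem squareClassEta_eq_quadraticChar (h2 : IsUnit (2 : R)) (u : Rˣ) :
    squareClassEta (squareClass u) =
      (quadraticChar (IsLocalRing.ResidueField R) (IsLocalRing.residue R u) : ℚ) := by
  have h0 : IsLocalRing.residue R u ≠ 0 := (u.isUnit.map (IsLocalRing.residue R)).ne_zero
  rw [squareClassEta_squareClass, isSquare_unit_iff_residue h2]
  split_ifs with h
  · rw [(quadraticChar_one_iff_isSquare h0).mpr h, Int.cast_one]
  · rw [quadraticChar_neg_one_iff_not_isSquare.mpr h, Int.cast_neg, Int.cast_one]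

theorem squareClassEta_mul (h2 : IsUnit (2 : R)) (c c' : SquareClass R) :
    squareClassEta (c * c') = squareClassEta c * squareClassEta c' := by
  obtain ⟨u, rfl⟩ := c.exists_rep
  obtain ⟨v, rfl⟩ := c'.exists_rep
  rw [← squareClass_mul, squareClassEta_eq_quadraticChar h2, squareClassEta_eq_quadraticChar h2,
    squareClassEta_eq_quadraticChar h2, Units.val_mul, map_mul, map_mul, Int.cast_mul]

theorem SquareClass.eq_of_ne_one (h2 : IsUnit (2 : R)) {c c' : SquareClass R} (hc : c ≠ 1)
    (hc' : c' ≠ 1) : c = c' := by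
  have h : squareClassEta (c * c') = 1 := by
    rw [squareClassEta_mul h2, (squareClassEta_eq_neg_one_iff c).mpr hc,
      (squareClassEta_eq_neg_one_iff c').mpr hc']
    norm_num
  rw [squareClassEta_eq_one_iff] at h
  calc c = c * c' * c' := by rw [mul_assoc, c'.mul_self]; exact (mul_one c).symm
    _ = c' := by rw [h, SquareClass.one_mul]

theorem quadraticChar_prod_eq_squareClassEta (h2 : IsUnit (2 : R)) {κ : Type*} [Fintype κ]
    (u : κ → Rˣ) (m : ℕ) :
    (quadraticChar (IsLocalRing.ResidueField R)
      ((-1) ^ m * ∏ j, IsLocalRing.residue R (u j)) : ℚ) =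
      squareClassEta (squareClass (-1) ^ m * ∏ j, squareClass (u j)) := by
  rw [← squareClass_prod, ← squareClass_pow, ← squareClass_mul, squareClassEta_eq_quadraticChar h2]
  congr 2
  simp [Units.coe_prod]

end SquareClasses

/-! ### Anisotropic unimodular forms -/

section Anisotropic

variable {R : Type*} [CommRing R] [IsDomain R] [IsDiscreteValuationRing R]
  [Fintype (IsLocalRing.ResidueField R)] [DecidableEq (IsLocalRing.ResidueField R)]
  {ι : Type*} [Fintype ι]

/-- Anisotropy says that the point count equals 1. In rank `2 m` this reads `q ^ m (q ^ m + (q - 1)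
χ) = q`, which forces `χ = -1` for `m = 1` and is impossible by size for `m ≥ 2`; in odd rank it
reads `q ^ n = q`. -/
theorem isotropicCard_eq_zero_iff (h2 : IsUnit (2 : R)) {u : ι → R} (hu : ∀ j, IsUnit (u j))
    (p : ι → Prop) :
    isotropicCard u p = 0 ↔
      formRank p = 0 ∨ formRank p = 1 ∨ (formRank p = 2 ∧ (formSign u p : ℚ) = -1) := by
  have h := isotropicCard_eq h2 hu p
  have hq : (1 : ℚ) < residueCard R := by exact_mod_cast one_lt_residueCard (R := R)
  have hs := formSign_eq_one_or u hu p
  set q : ℚ := (residueCard R : ℚ)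
  have hN : isotropicCard u p = 0 ↔
      q = q ^ formRank p * (1 + (q - 1) * signRatio (formSign u p) q (formRank p)) := by
    rw [← h]
    constructor
    · intro h0
      rw [h0]
      simp
    · intro h0
      have : q * (isotropicCard u p : ℚ) = 0 := by linarith
      exact_mod_cast (mul_eq_zero.mp this).resolve_left (by positivity)
  rw [hN]
  rcases Nat.even_or_odd' (formRank p) with ⟨m, hm | hm⟩
  · have hr : signRatio (formSign u p) q (formRank p) = formSign u p / q ^ m := by
      rw [signRatio, if_pos ⟨m, by omega⟩, hm, Nat.mul_div_cancel_left _ two_pos]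
    have hexp : q ^ formRank p * (1 + (q - 1) * signRatio (formSign u p) q (formRank p)) =
        q ^ m * (q ^ m + (q - 1) * formSign u p) := by
      rw [hr, hm, pow_mul', pow_two]
      field_simp
    rw [hexp, hm]
    rcases m with _ | _ | m
    · have h1 : (formSign u p : ℚ) = 1 := by
        have : IsEmpty {j // p j} := by
          rw [← Finite.card_eq_zero_iff]
          exact hm
        rw [formSign, hm]
        simp
      rw [h1]
      simp
    · simp only [zero_add, mul_one, pow_one, OfNat.ofNat_ne_zero, OfNat.ofNat_ne_one, false_or,
        true_and]
      rcases hs with h1 | h1 <;> rw [h1]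
      · constructor
        · intro h3
          nlinarith
        · intro h3
          norm_num at h3
      · simp
    · have h3 : ¬ (2 * (m + 1 + 1) = 0 ∨ 2 * (m + 1 + 1) = 1 ∨
          2 * (m + 1 + 1) = 2 ∧ (formSign u p : ℚ) = -1) := by omega
      simp only [h3, iff_false]
      have h4 : q * q ≤ q ^ (m + 1 + 1) := by
        rw [pow_succ, pow_succ, mul_assoc]
        exact le_mul_of_one_le_left (by positivity) (one_le_pow₀ hq.le)
      have h5 : -1 ≤ (formSign u p : ℚ) := by rcases hs with h1 | h1 <;> norm_num [h1]
      have h6 : 1 < q ^ (m + 1 + 1) + (q - 1) * formSign u p := by nlinarith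
      have h7 : q < q ^ (m + 1 + 1) := by nlinarith
      nlinarith
  · have hr : signRatio (formSign u p) q (formRank p) = 0 := by
      rw [signRatio, if_neg (Nat.not_even_iff_odd.mpr ⟨m, hm⟩)]
    rw [hr, mul_zero, add_zero, mul_one, hm]
    have h1 : ¬ (2 * m + 1 = 0) := by omega
    have h2 : ¬ (2 * m + 1 = 2) := by omega
    simp only [h1, h2, false_and, or_false, false_or]
    constructor
    · intro h3
      have := pow_right_injective₀ (by positivity) hq.ne' ((pow_one q).trans h3)
      exact this.symm
    · intro h3
      rw [h3, pow_one]

variable [HenselianRing R (IsLocalRing.maximalIdeal R)]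

theorem formSign_eq_squareClassEta (h2 : IsUnit (2 : R)) (u : ι → Rˣ) (p : ι → Prop)
    [DecidablePred p] :
    (formSign (fun j => (u j : R)) p : ℚ) =
      squareClassEta (squareClass (-1) ^ (formRank p / 2) * ∏ j : {j // p j}, squareClass (u j)) := by
  rw [← quadraticChar_prod_eq_squareClassEta h2, formSign]
  congr!

/-- A unimodular form is anisotropic modulo the maximal ideal if and only if its rank and
discriminant are `(0, 1)`, `(1, 1)`, `(1, α)` or `(2, -α)`. -/
theorem mem_anisotropic_iff (h2 : IsUnit (2 : R)) {α : Rˣ} (hα : ¬ IsSquare α) (u : ι → Rˣ)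
    (p : ι → Prop) [DecidablePred p] :
    (formRank p, ∏ j : {j // p j}, squareClass (u j)) ∈
      ({(0, 1), (1, 1), (1, squareClass α), (2, squareClass (-α))} : Set (ℕ × SquareClass R)) ↔
    isotropicCard (fun j => (u j : R)) p = 0 := by
  rw [isotropicCard_eq_zero_iff h2 (fun j => (u j).isUnit), formSign_eq_squareClassEta h2]
  have hα1 : squareClass α ≠ 1 := by rwa [ne_eq, squareClass_eq_one_iff]
  set c := ∏ j : {j // p j}, squareClass (u j) with hc
  have hc0 : formRank p = 0 → c = 1 := fun h => by
    have : IsEmpty {j // p j} := by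
      rw [← Finite.card_eq_zero_iff]
      exact h
    rw [hc, Finset.univ_eq_empty, Finset.prod_empty]
  have hneg : squareClass (-α) = squareClass (-1) * squareClass α := by
    rw [← squareClass_mul, neg_one_mul]
  have h22 : formRank p = 2 → (squareClassEta (squareClass (-1) ^ (formRank p / 2) * c) = -1 ↔
      c = squareClass (-α)) := fun h => by
    rw [h, squareClassEta_eq_neg_one_iff, Nat.div_self two_pos, pow_one, hneg]
    constructor
    · intro h1
      rw [← SquareClass.eq_of_ne_one h2 h1 hα1, ← mul_assoc, SquareClass.mul_self, SquareClass.one_mul]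
    · rintro h1
      rwa [h1, ← mul_assoc, SquareClass.mul_self, SquareClass.one_mul]
  have h11 : c = 1 ∨ c = squareClass α := or_iff_not_imp_left.mpr fun h =>
    SquareClass.eq_of_ne_one h2 h hα1
  simp only [Set.mem_insert_iff, Set.mem_singleton_iff, Prod.mk.injEq]
  constructor
  · rintro (h | h | h | h)
    · exact Or.inl h.1
    · exact Or.inr (Or.inl h.1)
    · exact Or.inr (Or.inl h.1)
    · exact Or.inr (Or.inr ⟨h.1, (h22 h.1).mpr h.2⟩)
  · rintro (h | h | h)
    · exact Or.inl ⟨h, hc0 h⟩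
    · rcases h11 with h1 | h1
      · exact Or.inr (Or.inl ⟨h, h1⟩)
      · exact Or.inr (Or.inr (Or.inl ⟨h, h1⟩))
    · exact Or.inr (Or.inr (Or.inr ⟨h.1, (h22 h.1).mp h.2⟩))

end Anisotropic

/-! ### Ranks and discriminants over blocks of given parity -/

section Sigma

theorem prod_subtype_sigma {κ : Type*} [Fintype κ] {ρ : κ → ℕ} (p : κ → Prop) [DecidablePred p]
    {G : Type*} [CommMonoid G] (f : (Σ i, Fin (ρ i)) → G) :
    ∏ j : {j : Σ i, Fin (ρ i) // p j.1}, f j = ∏ i with p i, ∏ j, f ⟨i, j⟩ := by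
  rw [← Finset.prod_subtype (Finset.univ.filter fun j : Σ i, Fin (ρ i) => p j.1) (by simp),
    Finset.prod_filter, Fintype.prod_sigma, Finset.prod_filter]
  refine Finset.prod_congr rfl fun i _ => ?_
  split_ifs <;> simp

theorem formRank_sigma {κ : Type*} [Fintype κ] {ρ : κ → ℕ} (p : κ → Prop) [DecidablePred p] :
    formRank (fun j : Σ i, Fin (ρ i) => p j.1) = ∑ i with p i, ρ i := by
  have h := prod_subtype_sigma (ρ := ρ) p fun _ => Multiplicative.ofAdd 1
  simp only [Finset.prod_const, ← ofAdd_nsmul, smul_eq_mul, mul_one, Finset.card_univ,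
    ← ofAdd_sum, Fintype.card_fin] at h
  rw [formRank, Nat.card_eq_fintype_card]
  exact Multiplicative.ofAdd.injective h

end Sigma

end

noncomputable section

/-! ### Lowest terms -/

section LowestTerms

variable {R : Type*} [CommRing R] [IsDomain R] [IsDiscreteValuationRing R]
  [TopologicalSpace R] [IsTopologicalRing R] [CompactSpace R]
  [MeasurableSpace R] [BorelSpace R] [Finite (IsLocalRing.ResidueField R)]
  {n : ℕ} {F : MvPolynomial (Fin n) R}

theorem EqFractionOnDisc.isReducedZetaFraction {Z : ℂ → ℂ} {f g : ℚ[X]}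
    (hF : ∀ s : ℂ, 0 < s.re → igusaZeta F s = Z ((residueCard R : ℂ) ^ (-s)))
    (h : EqFractionOnDisc Z f g) (hco : IsCoprime f g) (hg : g.coeff 0 = 1) :
    IsReducedZetaFraction F f g where
  coprime := hco
  coeff_zero := hg
  denom_ne_zero _ hs := h.aeval_denom_ne_zero hco (norm_residueCard_cpow_lt_one hs)
  eq_div s hs := by
    have ht := norm_residueCard_cpow_lt_one (R := R) hs
    rw [hF s hs, eq_div_iff (h.aeval_denom_ne_zero hco ht)]
    exact h _ ht

theorem IsReducedZetaFraction.mul_denom_eq {f g f' g' : ℚ[X]} (h : IsReducedZetaFraction F f g)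
    (h' : IsReducedZetaFraction F f' g') : f * g' = f' * g := by
  have hq : (1 : ℚ) < residueCard R := by exact_mod_cast one_lt_residueCard (R := R)
  -- The points `s = k + 1` lie in the half plane `Re s > 0` and give infinitely many rational
  -- values of `t`, enough for an identity of polynomials.
  set t : ℕ → ℚ := fun k => ((residueCard R : ℚ)⁻¹) ^ (k + 1) with ht
  have hinj : Function.Injective t := fun a b hab => by
    have := pow_right_injective₀ (inv_pos.mpr (by positivity)) (inv_lt_one_of_one_lt₀ hq).ne hab
    omega
  refine eq_of_infinite_eval_eq _ _ ((Set.infinite_range_of_injective hinj).mono ?_)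
  rintro _ ⟨k, rfl⟩
  have hs : (0 : ℝ) < ((k + 1 : ℕ) : ℂ).re := by
    rw [Complex.natCast_re]
    exact_mod_cast k.succ_pos
  have hcpow : (residueCard R : ℂ) ^ (-((k + 1 : ℕ) : ℂ)) = algebraMap ℚ ℂ (t k) := by
    rw [Complex.cpow_neg, Complex.cpow_natCast, ht, eq_ratCast]
    push_cast
    rw [inv_pow]
  have e := (h.eq_div _ hs).symm.trans (h'.eq_div _ hs)
  rw [div_eq_div_iff (h.denom_ne_zero _ hs) (h'.denom_ne_zero _ hs), hcpow] at e
  simp only [aeval_algebraMap_apply, coe_aeval_eq_eval, ← map_mul] at e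
  rw [Set.mem_ofPred_eq, eval_mul, eval_mul]
  exact (algebraMap ℚ ℂ).injective e

/-- By coprimality the denominators divide each other, hence differ by a constant, which the
normalization at 0 makes 1. -/
theorem IsReducedZetaFraction.denom_eq {f g f' g' : ℚ[X]} (h : IsReducedZetaFraction F f g)
    (h' : IsReducedZetaFraction F f' g') : g = g' := by
  have e := h.mul_denom_eq h'
  have d1 : g ∣ g' := h.coprime.symm.dvd_of_dvd_mul_left ⟨f', by rw [e, mul_comm]⟩
  have d2 : g' ∣ g := h'.coprime.symm.dvd_of_dvd_mul_left ⟨f, by rw [← e, mul_comm]⟩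
  obtain ⟨w, hw⟩ := associated_of_dvd_dvd d1 d2
  obtain ⟨c, -, hc⟩ := isUnit_iff.mp w.isUnit
  have h0 := congrArg (fun p : ℚ[X] => p.coeff 0) hw
  simp only [← hc, coeff_mul_C, h.coeff_zero, h'.coeff_zero, one_mul] at h0
  rw [← hw, ← hc, h0, C_1, mul_one]

end LowestTerms

/-! ### The zeta function of a quadratic form -/

theorem diagZeta_eq_zero {R ι : Type*} [CommRing R] [TopologicalSpace R] [IsTopologicalRing R]
    [CompactSpace R] [MeasurableSpace R] [BorelSpace R] [Fintype ι] [IsEmpty ι] (ϖ : R) (u : ι → R) (e : ι → ℕ) (t : ℂ) :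
    diagZeta ϖ u e t = 0 := by
  have h : ∀ k, diagDensity ϖ u e k = 1 := fun k => by
    simp [diagDensity, diagForm]
  simp [diagZeta, differenceSeries, h]

section QuadraticZeta

variable {R : Type*} [CommRing R] [IsDomain R] [IsDiscreteValuationRing R]
  [TopologicalSpace R] [IsTopologicalRing R] [CompactSpace R] [T2Space R]
  [MeasurableSpace R] [BorelSpace R] [SecondCountableTopology R]
  {ι : Type*} [Fintype ι] {n : ℕ} {F : MvPolynomial (Fin n) R}

theorem igusaZeta_eq_diagZeta {ϖ : R} (hϖ : Irreducible ϖ) {u : ι → R} {e : ι → ℕ}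
    {f : (Fin n → R) →ₗ[R] (ι → R)} (hf : Function.Surjective f)
    (hF : ∀ x, MvPolynomial.eval x F = diagForm ϖ u e (f x)) {s : ℂ} (hs : 0 < s.re) :
    Integrable (fun x => ((normalizedAbs (MvPolynomial.eval x F) : ℝ) : ℂ) ^ s) (haarPi R n) ∧
      igusaZeta F s = diagZeta ϖ u e ((residueCard R : ℂ) ^ (-s)) := by
  have hmp := measurePreserving_of_linear_surjective f hf
  have hset : ∀ k : ℕ, {x | ϖ ^ k ∣ MvPolynomial.eval x F} =
      f ⁻¹' {y | ϖ ^ k ∣ diagForm ϖ u e y} := fun k => by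
    ext x
    simp [hF]
  have hmeas : ∀ k : ℕ, MeasurableSet {x | ϖ ^ k ∣ MvPolynomial.eval x F} := fun k => by
    rw [hset]
    exact hmp.measurable (measurableSet_dvd_diagForm ϖ u e _)
  have h := hasSum_integral_normalizedAbs_cpow (μ := haarProb R (Fin n)) hϖ hmeas hs
  refine ⟨h.1, ?_⟩
  have hd : ∀ k : ℕ, (haarProb R (Fin n)).real {x | ϖ ^ k ∣ MvPolynomial.eval x F} =
      diagDensity ϖ u e k := fun k => by
    rw [hset, diagDensity, measureReal_def, measureReal_def,
      hmp.measure_preimage (measurableSet_dvd_diagForm ϖ u e _).nullMeasurableSet]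
  simp_rw [hd] at h
  exact h.2.tsum_eq.symm

end QuadraticZeta

end

/-! ### Assembly of the main theorem -/

theorem theorem3
    (p : ℕ) [Fact p.Prime] (hp : Odd p)
    (K : Type*) [Field K] [CharZero K] [ValuativeRel K] [TopologicalSpace K]
    [IsNonarchimedeanLocalField K] [CharP 𝓀[K] p]
    [MeasurableSpace 𝒪[K]] [BorelSpace 𝒪[K]]
    (q : ℕ) (hq : q = residueCard 𝒪[K])
    (ϖ : 𝒪[K]) (hϖ : Irreducible ϖ)
    (α : 𝒪[K]ˣ) (hα : ¬ IsSquare α)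
    -- the quadratic form `Q`, given by a symmetric matrix
    (n : ℕ) (A : Matrix (Fin n) (Fin n) 𝒪[K]) (hA : A.IsSymm)
    -- the unimodular forms `Qᵢ`, of rank `ρ i`; they are zero for `N ≤ i`
    (N : ℕ) (ρ : Fin N → ℕ) (M : ∀ i, Matrix (Fin (ρ i)) (Fin (ρ i)) 𝒪[K])
    (hM : ∀ i, (M i).IsSymm) (hdet : ∀ i, IsUnit (M i).det)
    (m : ℕ) (hequiv : A.toQuadraticForm'.Equivalent (diagonalSum ϖ M m))
    (r rEven rOdd : ℕ)
    (hr : r = ∑ i, ρ i)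
    (hrEven : rEven = ∑ i : Fin N with Even i.val, ρ i)
    (hrOdd : rOdd = ∑ i : Fin N with Odd i.val, ρ i)
    (d dEven dOdd : SquareClass 𝒪[K])
    (hd : d = ∏ i, unimodularDisc (M i) (hdet i))
    (hdEven : dEven = ∏ i : Fin N with Even i.val, unimodularDisc (M i) (hdet i))
    (hdOdd : dOdd = ∏ i : Fin N with Odd i.val, unimodularDisc (M i) (hdet i))
    (S : Set (ℕ × SquareClass 𝒪[K]))
    (hS : S = {(0, 1), (1, 1), (1, squareClass α), (2, squareClass (-α))}) :
    (∀ s : ℂ, 0 < s.re →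
      Integrable (fun x => ((normalizedAbs (MvPolynomial.eval x (quadPoly A)) : ℝ) : ℂ) ^ s)
        (haarPi 𝒪[K] n)) ∧
    (∃ f g : ℚ[X], IsReducedZetaFraction (quadPoly A) f g) ∧
    ∀ f g : ℚ[X], IsReducedZetaFraction (quadPoly A) f g →
      (r = 0 → g = 1) ∧
      (0 < r → {(rEven, dEven), (rOdd, dOdd)} ⊆ S →
        (rEven = rOdd → g = 1 - C (1 / (q : ℚ) ^ (r / 2)) * X) ∧
        (rEven ≠ rOdd → g = 1 - C (1 / (q : ℚ) ^ r) * X ^ 2)) ∧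
      (0 < r → ¬ {(rEven, dEven), (rOdd, dOdd)} ⊆ S →
        (Odd rEven ∧ Odd rOdd → g = 1 - C (1 / (q : ℚ)) * X) ∧
        (Even rEven ∧ Even rOdd →
          g = (1 - C (1 / (q : ℚ)) * X) *
            (1 - C (squareClassEta (squareClass (-1) ^ (r / 2) * d) / (q : ℚ) ^ (r / 2)) * X)) ∧
        (¬ rEven ≡ rOdd [MOD 2] →
          g = (1 - C (1 / (q : ℚ)) * X) * (1 - C (1 / (q : ℚ) ^ r) * X ^ 2))) := by
  classical
  have h2 : IsUnit (2 : 𝒪[K]) := by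
    rw [← IsLocalRing.residue_ne_zero_iff_isUnit, map_ofNat]
    have hp2 : p ≠ 2 := fun h => by rw [h] at hp; exact absurd hp (by decide)
    intro h0
    have h3 : ((2 : ℕ) : 𝓀[K]) = 0 := by exact_mod_cast h0
    rw [CharP.cast_eq_zero_iff 𝓀[K] p] at h3
    exact hp2 ((Nat.prime_dvd_prime_iff_eq Fact.out Nat.prime_two).mp h3)
  have := Fintype.ofFinite (IsLocalRing.ResidueField 𝒪[K])
  have hhens : HenselianRing 𝒪[K] (IsLocalRing.maximalIdeal 𝒪[K]) := by
    let := IsTopologicalAddGroup.rightUniformSpace K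
    have := isUniformAddGroup_of_addCommGroup (G := K)
    have : IsAdicComplete (IsLocalRing.maximalIdeal 𝒪[K]) 𝒪[K] := inferInstance
    infer_instance
  have hT2 : T2Space K := by
    let := IsTopologicalAddGroup.rightUniformSpace K
    have := isUniformAddGroup_of_addCommGroup (G := K)
    infer_instance
  have := IsDiscreteValuationRing.secondCountableTopology 𝒪[K]
  obtain ⟨u, π, hdisc, hπ, hF⟩ := exists_diagForm_pullback h2 ϖ A M hM hdet hequiv
  set e : (Σ i, Fin (ρ i)) → ℕ := fun j => j.1 with he
  have hu : ∀ j, IsUnit ((fun j => (u j : 𝒪[K])) j) := fun j => (u j).isUnit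
  have hzeta := fun (s : ℂ) (hs : 0 < s.re) => igusaZeta_eq_diagZeta hϖ hπ hF hs
  have hrE : formRank (fun j => Even (e j)) = rEven := by
    rw [hrEven]; exact formRank_sigma fun i : Fin N => Even i.val
  have hrO : formRank (fun j => Odd (e j)) = rOdd := by
    rw [hrOdd]; exact formRank_sigma fun i : Fin N => Odd i.val
  have hdE : ∏ j : {j // Even (e j)}, squareClass (u j) = dEven := by
    rw [hdEven, Finset.prod_congr rfl fun i _ => hdisc i]
    exact prod_subtype_sigma (fun i : Fin N => Even i.val) fun j => squareClass (u j)
  have hdO : ∏ j : {j // Odd (e j)}, squareClass (u j) = dOdd := by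
    rw [hdOdd, Finset.prod_congr rfl fun i _ => hdisc i]
    exact prod_subtype_sigma (fun i : Fin N => Odd i.val) fun j => squareClass (u j)
  have hsum : r = rEven + rOdd := by
    rw [hr, hrEven, hrOdd, ← Finset.sum_filter_add_sum_filter_not _ fun i : Fin N => Even i.val]
    simp only [Nat.not_even_iff_odd]
  have hprod : d = dEven * dOdd := by
    rw [hd, hdEven, hdOdd,
      ← Finset.prod_filter_mul_prod_filter_not _ fun i : Fin N => Even i.val]
    simp only [Nat.not_even_iff_odd]
  have hmemE := mem_anisotropic_iff h2 hα u fun j => Even (e j)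
  have hmemO := mem_anisotropic_iff h2 hα u fun j => Odd (e j)
  have hsE := formSign_eq_squareClassEta h2 u fun j => Even (e j)
  have hsO := formSign_eq_squareClassEta h2 u fun j => Odd (e j)
  rw [hrE, hdE, ← hS] at hmemE
  rw [hrO, hdO, ← hS] at hmemO
  rw [hrE, hdE] at hsE
  rw [hrO, hdO] at hsO
  have hsub : {(rEven, dEven), (rOdd, dOdd)} ⊆ S ↔
      isotropicCard (fun j => (u j : 𝒪[K])) (fun j => Even (e j)) = 0 ∧
      isotropicCard (fun j => (u j : 𝒪[K])) (fun j => Odd (e j)) = 0 := by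
    rw [← hmemE, ← hmemO, Set.insert_subset_iff, Set.singleton_subset_iff]
  have hqQ : (q : ℚ) = residueCard 𝒪[K] := by rw [hq]
  have hq1 : (1 : ℚ) < q := by rw [hqQ]; exact_mod_cast one_lt_residueCard (R := 𝒪[K])
  refine ⟨fun s hs => (hzeta s hs).1, ?_⟩
  suffices H : ∃ f g : ℚ[X], IsReducedZetaFraction (quadPoly A) f g ∧
      ((r = 0 → g = 1) ∧
      (0 < r → {(rEven, dEven), (rOdd, dOdd)} ⊆ S →
        (rEven = rOdd → g = 1 - C (1 / (q : ℚ) ^ (r / 2)) * X) ∧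
        (rEven ≠ rOdd → g = 1 - C (1 / (q : ℚ) ^ r) * X ^ 2)) ∧
      (0 < r → ¬ {(rEven, dEven), (rOdd, dOdd)} ⊆ S →
        (Odd rEven ∧ Odd rOdd → g = 1 - C (1 / (q : ℚ)) * X) ∧
        (Even rEven ∧ Even rOdd →
          g = (1 - C (1 / (q : ℚ)) * X) *
            (1 - C (squareClassEta (squareClass (-1) ^ (r / 2) * d) / (q : ℚ) ^ (r / 2)) * X)) ∧
        (¬ rEven ≡ rOdd [MOD 2] →
          g = (1 - C (1 / (q : ℚ)) * X) * (1 - C (1 / (q : ℚ) ^ r) * X ^ 2)))) by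
    obtain ⟨f, g, hfg, hg⟩ := H
    refine ⟨⟨f, g, hfg⟩, fun f' g' hfg' => ?_⟩
    rwa [hfg'.denom_eq hfg]
  have hZ : ∀ s : ℂ, 0 < s.re → igusaZeta (quadPoly A) s =
      diagZeta ϖ (fun j => (u j : 𝒪[K])) e ((residueCard 𝒪[K] : ℂ) ^ (-s)) :=
    fun s hs => (hzeta s hs).2
  rcases Nat.eq_zero_or_pos r with hr0 | hr0
  · have hempty : IsEmpty (Σ i, Fin (ρ i)) := by
      rw [← Fintype.card_eq_zero_iff, Fintype.card_sigma]
      simpa [hr] using hr0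
    -- In rank 0 the form is identically zero and so is the zeta function; its reduced fraction is
    -- `0 / 1`.
    refine ⟨0, 1, EqFractionOnDisc.isReducedZetaFraction hZ (fun t _ => ?_) isCoprime_one_right
      coeff_one_zero, fun _ => rfl, fun h => absurd h (by omega), fun h => absurd h (by omega)⟩
    rw [diagZeta_eq_zero, map_zero, zero_mul]
  by_cases hiso : {(rEven, dEven), (rOdd, dOdd)} ⊆ S
  · obtain ⟨hE, hO⟩ := hsub.mp hiso
    obtain ⟨f, g, hg, hfg, hco⟩ := exists_fraction_diagZeta_of_anisotropic hϖ h2 hu hqQ e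
      (by rw [hrE, hrO]; omega) hE hO
    rw [hrE, hrO] at hg
    refine ⟨f, g, EqFractionOnDisc.isReducedZetaFraction hZ hfg hco
      (by rw [hg]; exact coeff_zero_anisotropicDenom _ _ _), fun h => absurd h (by omega),
      fun _ _ => ⟨fun h => ?_, fun h => ?_⟩, fun _ h => absurd hiso h⟩
    · rw [hg, anisotropicDenom, if_pos h, show r / 2 = rEven by omega]
    · rw [hg, anisotropicDenom, if_neg h, ← hsum]
  · have hpos : 0 < isotropicCard (fun j => (u j : 𝒪[K])) (fun j => Even (e j)) +
        isotropicCard (fun j => (u j : 𝒪[K])) (fun j => Odd (e j)) := by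
      by_contra hcon
      exact hiso (hsub.mpr (by omega))
    -- In total rank at most 1 both parts have rank at most 1 and would be anisotropic.
    have hr2 : 2 ≤ formRank (fun j => Even (e j)) + formRank (fun j => Odd (e j)) := by
      by_contra hcon
      have h1 := (isotropicCard_eq_zero_iff h2 hu fun j => Even (e j)).mpr (by omega)
      have h2 := (isotropicCard_eq_zero_iff h2 hu fun j => Odd (e j)).mpr (by omega)
      omega
    obtain ⟨f, h, hh, hfg, hco, hfq⟩ :=
      exists_fraction_diagZeta_of_isotropic hϖ h2 hu hqQ e hr2 hpos
    rw [hrE, hrO, hsE, hsO] at hh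
    refine ⟨f, _, EqFractionOnDisc.isReducedZetaFraction hZ hfg
      ((isCoprime_one_sub_C_mul_X (by positivity) hfq.ne').mul_right hco) ?_,
      fun h => absurd h (by omega), fun _ h => absurd h hiso,
      fun _ _ => ⟨fun hpar => ?_, fun hpar => ?_, fun hpar => ?_⟩⟩
    · rw [mul_coeff_zero, hh, coeff_zero_cofactor]
      simp
    · rw [hh, cofactor, if_pos hpar, mul_one]
    · have hnot : ¬ (Odd rEven ∧ Odd rOdd) := fun h => Nat.not_even_iff_odd.mpr h.1 hpar.1
      have hhalf : r / 2 = rEven / 2 + rOdd / 2 := by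
        obtain ⟨⟨a, ha⟩, ⟨b, hb⟩⟩ := hpar
        omega
      have hclass : squareClass (-1) ^ (rEven / 2) * dEven * (squareClass (-1) ^ (rOdd / 2) * dOdd) =
          squareClass (-1 : 𝒪[K]ˣ) ^ (rEven / 2 + rOdd / 2) * (dEven * dOdd) :=
        SquareClass.pow_mul_mul_pow_mul _ _ _ _ _
      -- The two signs merge into `η((-1) ^ (r / 2) d)` because `η` is multiplicative and halving is
      -- additive on even ranks.
      rw [hh, cofactor, if_neg hnot, if_pos hpar, ← hsum, ← squareClassEta_mul h2, hprod, hhalf,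
        hclass]
    · have hnot : ¬ (Odd rEven ∧ Odd rOdd) := fun h => hpar (by
        rw [Nat.ModEq, Nat.odd_iff.mp h.1, Nat.odd_iff.mp h.2])
      have hnot' : ¬ (Even rEven ∧ Even rOdd) := fun h => hpar (by
        rw [Nat.ModEq, Nat.even_iff.mp h.1, Nat.even_iff.mp h.2])
      rw [hh, cofactor, if_neg hnot, if_neg hnot', ← hsum]
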